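/- Let $a<b$, let $\mu\sim\mathcal U(a,b)$ have mean $\bar\mu$ and standard deviation $\sigma$, and let $I_\xi=[-\sqrt3,\sqrt3]$ be the support of $\xi=(\mu-\bar\mu)/\sigma$. Norms and inner products in $L^2$ and $L^\infty$ refer to Lebesgue measure on $I_\xi$. Let $f:\mathbb R^n\times[a,b]\to\mathbb R^n$ be continuous, and locally Lipschitz in its first variable uniformly in the parameter: for every $R>0$ there is $L_R>0$ with $\|f(u_1,m)-f(u_2,m)\|\le L_R\|u_1-u_2\|$ for all $\|u_1\|,\|u_2\|\le R$ and $m\in[a,b]$. Assume that $f$ is differentiable in its first variable and that $D_uf$ (with the operator norm) is also locally Lipschitz in the first variable, uniformly in the parameter, in the same sense. Let $\bar u\in C(I_\xi;\mathbb R^n)$ be a solution branch, $f(\bar u(z),\bar\mu+\sigma z)=0$ for all $z\in I_\xi$, with $\bar u\in H^s(I_\xi;\mathbb R^n)$ for some real $s\ge1$, and suppose that for some $\lambda_{\min}>0$ $$\langle D_uf(\bar u(z),\bar\mu+\sigma z)w,w\rangle\ \ge\ \lambda_{\min}\|w\|^2\qquad\forall z\in I_\xi,\ \forall w\in\mathbb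 R^n .$$ Let $(\Phi_k)_{k\ge0}$ be real polynomials with $\deg\Phi_k=k$, mutually orthogonal in $L^2(I_\xi)$ (Legendre polynomials on $I_\xi$, arbitrarily scaled). For $\hat u=(\hat u_0,\dots,\hat u_N)\in(\mathbb R^n)^{N+1}$ put $\mathcal I_n(\hat u)=\sum_{j=0}^N\hat u_j\Phi_j$ and $|\hat u|_*=\bigl(\sum_{i=0}^N\|\hat u_i\|^2\|\Phi_i\|_{L^2}^2\bigr)^{1/2}=\|\mathcal I_n(\hat u)\|_{L^2}$, and write $|A|_*$ for the induced operator norm of a linear map $A$ of $(\mathbb R^n)^{N+1}$. The Galerkin operator is $$F_N(\hat u)_i=\frac{1}{\|\Phi_i\|_{L^2}^2}\int_{I_\xi}f\bigl(\mathcal I_n(\hat u)(z),\bar\mu+\sigma z\bigr)\Phi_i(z)\,dz,\qquad i=0,\dots,N,$$ $JF_N(\hat u)$ is its Jacobian at $\hat u$, and $a^{(N)}_i=\|\Phi_i\|_{L^2}^{-2}\int_{I_\xi}\bar u\,\Phi_i\,dz$ ($0\le i\le N$) are the coefficients of the best $L^2$-approximation $u_{LS,N}$ of $\bar u$ by polynomials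 of degree at most $N$. Then there exist an integer $N_0>0$, an $L^\infty$-neighbourhood $U$ of $\bar u$, and constants $K(N)$ with $K(N)=\mathcal O(N)$ as $N\to\infty$, such that for every $N\ge N_0$: $F_N$ is differentiable, $JF_N(a^{(N)})$ is invertible, $$\bigl|JF_N(a^{(N)})^{-1}\bigr|_*\le\frac{2}{\lambda_{\min}},$$ and $$|JF_N(\hat u_1)-JF_N(\hat u_2)|_*\le K(N)\,|\hat u_1-\hat u_2|_*\qquad\text{whenever }\mathcal I_n(\hat u_1),\mathcal I_n(\hat u_2)\in U .$$ -/

import Mathlib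

open Set Filter Topology MeasureTheory Asymptotics
open scoped ENNReal Polynomial RealInnerProductSpace

namespace PCE

noncomputable section

/-! ### The parameter and its normalisation -/

/-- The law of a parameter that is uniformly distributed on `[a, b]`. -/
def uniformLaw (a b : ℝ) : Measure ℝ := ProbabilityTheory.cond volume (Icc a b)

/-- The mean of the uniform parameter. -/
def paramMean (a b : ℝ) : ℝ := ∫ x, x ∂(uniformLaw a b)

/-- The standard deviation of the uniform parameter. -/
def paramStd (a b : ℝ) : ℝ := √(∫ x, (x - paramMean a b) ^ 2 ∂(uniformLaw a b))

/-- The interval on which the normalised uniform random variable is supported. -/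
def Ixi : Set ℝ := Icc (-√3) √3

/-- Lebesgue measure on `Ixi`; all `L²` and `L^∞` notions refer to it. -/
def lebXi : Measure ℝ := volume.restrict Ixi

/-- The parameter that corresponds to the normalised variable `z`. -/
def param (a b z : ℝ) : ℝ := paramMean a b + paramStd a b * z

/-! ### Sobolev spaces on the interval -/

section Sobolev

variable {E : Type*} [NormedAddCommGroup E] [NormedSpace ℝ E]

/-- `g` is a weak derivative of order `k` of `u` on the interior of `Ixi`. -/
def HasWeakDeriv (k : ℕ) (u g : ℝ → E) : Prop :=
  ∀ φ : ℝ → ℝ, ContDiff ℝ ((⊤ : ℕ∞) : WithTop ℕ∞) φ → HasCompactSupport φ → tsupport φ ⊆ interior Ixi →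
    ∫ z, iteratedDeriv k φ z • u z ∂lebXi = (-1 : ℝ) ^ k • ∫ z, φ z • g z ∂lebXi

/-- The square of the Gagliardo (Slobodeckij) seminorm of order `θ`. -/
def gagliardo (θ : ℝ) (g : ℝ → E) : ℝ≥0∞ :=
  ∫⁻ x, ∫⁻ y, ENNReal.ofReal (‖g x - g y‖ ^ 2 / |x - y| ^ (1 + 2 * θ)) ∂lebXi ∂lebXi

/-- Membership in the Sobolev space `H^s` of real order `s ≥ 0`: the weak derivatives up to the
order `⌊s⌋` are square integrable, and for a non-integer `s` the one of order `⌊s⌋` has a finite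
Gagliardo seminorm of order `s - ⌊s⌋`. -/
def MemHs (s : ℝ) (u : ℝ → E) : Prop :=
  MemLp u 2 lebXi ∧
    ∀ k : ℕ, k ≤ ⌊s⌋₊ → ∃ g : ℝ → E, MemLp g 2 lebXi ∧ HasWeakDeriv k u g ∧
      (k = ⌊s⌋₊ → (k : ℝ) < s → gagliardo (s - k) g < ∞)

/-- `U` is an `L^∞`-neighbourhood of `u`: it contains an open ball of positive radius. -/
def IsLinftyNhd (U : Set (ℝ → E)) (u : ℝ → E) : Prop :=
  ∃ r : ℝ, 0 < r ∧ ∀ v : ℝ → E, AEStronglyMeasurable v lebXi →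
    eLpNorm (v - u) ∞ lebXi < ENNReal.ofReal r → v ∈ U

/-- `g` is locally Lipschitz in the first variable, uniformly in the parameter in `I`. -/
def LocLipUnif {G : Type*} [NormedAddCommGroup G] (g : E → ℝ → G) (I : Set ℝ) : Prop :=
  ∀ R : ℝ, 0 < R → ∃ L : ℝ, 0 < L ∧ ∀ u₁ u₂ : E, ‖u₁‖ ≤ R → ‖u₂‖ ≤ R → ∀ m ∈ I,
    ‖g u₁ m - g u₂ m‖ ≤ L * ‖u₁ - u₂‖

/-- The partial derivative of `f` in the state variable. -/
def stateDeriv (f : E → ℝ → E) (u : E) (m : ℝ) : E →L[ℝ] E := fderiv ℝ (fun v => f v m) u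

end Sobolev

/-! ### Orthogonal polynomials and the Galerkin system -/

/-- `Φ k` has degree exactly `k`, and distinct members are orthogonal on `Ixi`: these are exactly
the Legendre polynomials rescaled to `Ixi`, each with an arbitrary nonzero factor. -/
def IsOrthogonalFamily (Φ : ℕ → ℝ[X]) : Prop :=
  (∀ k, (Φ k).degree = k) ∧
    ∀ i j, i ≠ j → ∫ z, (Φ i).eval z * (Φ j).eval z ∂lebXi = 0

/-- The squared `L²` norm of `Φ i`. -/
def sqNorm (Φ : ℕ → ℝ[X]) (i : ℕ) : ℝ := ∫ z, (Φ i).eval z ^ 2 ∂lebXi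

section Galerkin

variable {n : ℕ}

/-- Coefficient vectors: `N + 1` blocks of size `n`. -/
abbrev Coeff (n N : ℕ) : Type := Fin (N + 1) → EuclideanSpace ℝ (Fin n)

/-- The polynomial curve `∑ⱼ cⱼ Φⱼ` with coefficients `c`. -/
def synth (Φ : ℕ → ℝ[X]) {N : ℕ} (c : Coeff n N) (z : ℝ) : EuclideanSpace ℝ (Fin n) :=
  ∑ j : Fin (N + 1), (Φ j).eval z • c j

/-- The coefficients `⟨v, Φᵢ⟩ / ‖Φᵢ‖²` of the `L²`-orthogonal projection of `v` onto the span of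
`Φ₀, …, Φ_N`, that is, of the best approximation (least-squares approximation) of `v`. -/
def projCoeff (Φ : ℕ → ℝ[X]) (N : ℕ) (v : ℝ → EuclideanSpace ℝ (Fin n)) : Coeff n N :=
  fun i => (sqNorm Φ i)⁻¹ • ∫ z, (Φ i).eval z • v z ∂lebXi

/-- The Nemytskii operator of `f` in the normalised variable. -/
def nemytskii (f : EuclideanSpace ℝ (Fin n) → ℝ → EuclideanSpace ℝ (Fin n)) (a b : ℝ)
    (u : ℝ → EuclideanSpace ℝ (Fin n)) (z : ℝ) : EuclideanSpace ℝ (Fin n) :=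
  f (u z) (param a b z)

/-- The (scaled) Galerkin operator `F_N` on coefficient vectors. -/
def galerkin (f : EuclideanSpace ℝ (Fin n) → ℝ → EuclideanSpace ℝ (Fin n)) (a b : ℝ)
    (Φ : ℕ → ℝ[X]) (N : ℕ) (c : Coeff n N) : Coeff n N :=
  projCoeff Φ N (nemytskii f a b (synth Φ c))

/-- The Jacobian of the Galerkin operator, as a linear operator on coefficient vectors. -/
def galerkinJacobian (f : EuclideanSpace ℝ (Fin n) → ℝ → EuclideanSpace ℝ (Fin n)) (a b : ℝ)
    (Φ : ℕ → ℝ[X]) (N : ℕ) (c : Coeff n N) : Coeff n N →L[ℝ] Coeff n N :=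
  fderiv ℝ (galerkin f a b Φ N) c

/-- The weighted norm `(∑ᵢ ‖cᵢ‖² ‖Φᵢ‖²)^{1/2}`. -/
def starNorm (Φ : ℕ → ℝ[X]) {N : ℕ} (c : Coeff n N) : ℝ :=
  √(∑ i : Fin (N + 1), ‖c i‖ ^ 2 * sqNorm Φ i)

/-- The operator norm induced by the weighted norm: the least `C ≥ 0` such that
`starNorm (A c) ≤ C * starNorm c` for all `c`. -/
def starOpNorm (Φ : ℕ → ℝ[X]) {N : ℕ} (A : Coeff n N →L[ℝ] Coeff n N) : ℝ :=
  sInf {C : ℝ | 0 ≤ C ∧ ∀ c, starNorm Φ (A c) ≤ C * starNorm Φ c}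

end Galerkin

end

end PCE

namespace PCE

/-! ### Integrals of polynomials over `Ixi` -/

/-! By orthogonality, `starNorm` of coefficients is the `L²` norm of the polynomial curve they
synthesise, and the Jacobian at `c` sends `h` to the projection of `D_u f(synth c) · synth h`. Both
estimates are thus about multiplication by `D_u f` followed by an orthogonal projection.

Inverse: testing the Jacobian with `h` gives `∫ ⟨D_u f(synth c) synth h, synth h⟩`. If the
projection of `u` is uniformly so close to `u` that `D_u f` moves by at most `lam / 2`, this form is
coercive with constant `lam / 2`. The Jacobian is then injective, hence invertible in finite
dimension, with inverse bounded by `2 / lam`.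

Lipschitz bound: Bessel removes the projection. In the product of `D_u f(v₁) - D_u f(v₂)` with `w`,
the first factor is measured in `L²` and the second in the maximum norm. Nikolskii's inequality
`‖w‖_∞ ≤ (N + 1) ‖w‖_{L²}` for degree at most `N` yields `K N = L (N + 1)`. It follows from `Φ_k² ≤
(2k + 1) ‖Φ_k‖²` and `1 + 3 + ⋯ + (2N + 1) = (N + 1)²`.

The delicate point is uniform convergence of the `L²` projections of an `H¹` function. Subtracting
from a polynomial `p` a primitive of the projection of `p'` leaves `e`, vanishing at both ends. A
duality argument gives `‖e‖_{L²} = O(‖e'‖_{L²} / N)`, which exactly pays for the factor `N` in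
Nikolskii's inequality. So the uniform projection error is bounded by `‖p'‖_{L²}` independently of
`N`, and density of polynomials finishes. -/

lemma sqrt_three_pos : (0 : ℝ) < √3 := Real.sqrt_pos.2 (by norm_num)

lemma neg_sqrt_three_le : -√3 ≤ √3 := by linarith [sqrt_three_pos]

lemma sq_sqrt_three : √3 * √3 = (3 : ℝ) := Real.mul_self_sqrt (by norm_num)

lemma sqrt_three_le : √3 ≤ 2 := by nlinarith [sqrt_three_pos, sq_sqrt_three]

lemma one_le_sqrt_three : 1 ≤ √3 := by nlinarith [sqrt_three_pos, sq_sqrt_three]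

instance isFiniteMeasure_lebXi : IsFiniteMeasure lebXi := by
  unfold lebXi Ixi; infer_instance

lemma integral_lebXi {E : Type*} [NormedAddCommGroup E] [NormedSpace ℝ E] (v : ℝ → E) :
    ∫ z, v z ∂lebXi = ∫ z in (-√3)..√3, v z := by
  rw [intervalIntegral.integral_of_le neg_sqrt_three_le, lebXi, Ixi, integral_Icc_eq_integral_Ioc]

lemma ae_mem_Ixi : ∀ᵐ z ∂lebXi, z ∈ Ixi := ae_restrict_mem measurableSet_Icc

lemma integrable_lebXi_of_continuousOn {E : Type*} [NormedAddCommGroup E] {v : ℝ → E}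
    (hv : ContinuousOn v Ixi) : Integrable v lebXi :=
  hv.integrableOn_compact isCompact_Icc

lemma integrable_polynomial (p : ℝ[X]) : Integrable (fun z => p.eval z) lebXi :=
  integrable_lebXi_of_continuousOn p.continuous.continuousOn

/-- Integration of polynomials over `Ixi`. -/
noncomputable def polyInt : ℝ[X] →ₗ[ℝ] ℝ where
  toFun p := ∫ z, p.eval z ∂lebXi
  map_add' p q := by
    simp only [Polynomial.eval_add]
    exact integral_add (integrable_polynomial p) (integrable_polynomial q)
  map_smul' c p := by
    simp only [Polynomial.eval_smul, RingHom.id_apply]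
    exact integral_smul c _

lemma polyInt_apply (p : ℝ[X]) : polyInt p = ∫ z, p.eval z ∂lebXi := rfl

lemma polyInt_C_mul (c : ℝ) (p : ℝ[X]) : polyInt (Polynomial.C c * p) = c * polyInt p := by
  rw [← Polynomial.smul_eq_C_mul, map_smul, smul_eq_mul]

lemma polyInt_derivative (p : ℝ[X]) :
    polyInt (Polynomial.derivative p) = p.eval √3 - p.eval (-√3) := by
  rw [polyInt_apply, integral_lebXi]
  exact intervalIntegral.integral_eq_sub_of_hasDerivAt (fun x _ => p.hasDerivAt x)
    ((Polynomial.derivative p).continuous.intervalIntegrable _ _)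

lemma polyInt_nonneg {p : ℝ[X]} (hp : ∀ z ∈ Ixi, 0 ≤ p.eval z) : 0 ≤ polyInt p :=
  integral_nonneg_of_ae (ae_mem_Ixi.mono hp)

lemma polyInt_mono {p q : ℝ[X]} (h : ∀ z ∈ Ixi, p.eval z ≤ q.eval z) : polyInt p ≤ polyInt q :=
  integral_mono_ae (integrable_polynomial p) (integrable_polynomial q) (ae_mem_Ixi.mono h)

lemma polyInt_mul_self_nonneg (p : ℝ[X]) : 0 ≤ polyInt (p * p) :=
  polyInt_nonneg fun z _ => by simpa using mul_self_nonneg (p.eval z)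

/-- Vanishing almost everywhere becomes vanishing on the whole interval by continuity, which is
infinitely many roots. This makes `polyInt (p * q)` an inner product. -/
lemma eq_zero_of_polyInt_mul_self {p : ℝ[X]} (h : polyInt (p * p) = 0) : p = 0 := by
  have h0 : (fun z => (p * p).eval z) =ᵐ[lebXi] 0 :=
    (integral_eq_zero_iff_of_nonneg (fun z => by simpa using mul_self_nonneg (p.eval z))
      (integrable_polynomial _)).1 h
  have h1 : EqOn (fun z => (p * p).eval z) 0 (Icc (-√3) √3) := by
    refine Measure.eqOn_Icc_of_ae_eq volume (by linarith [sqrt_three_pos]) h0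
      (p * p).continuous.continuousOn continuousOn_const
  refine p.eq_zero_of_infinite_isRoot (Set.Infinite.mono (s := Icc (-√3) √3) ?_
    (Icc_infinite (by linarith [sqrt_three_pos])))
  intro z hz
  simpa using h1 hz

lemma polyInt_mul_self_pos {p : ℝ[X]} (h : p ≠ 0) : 0 < polyInt (p * p) :=
  lt_of_le_of_ne (polyInt_mul_self_nonneg p) fun h0 => h (eq_zero_of_polyInt_mul_self h0.symm)

/-- Cauchy–Schwarz, from the discriminant of the nonnegative quadratic `t ↦ polyInt ((p + t q)²)`.
-/
lemma polyInt_mul_sq_le (p q : ℝ[X]) :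
    polyInt (p * q) ^ 2 ≤ polyInt (p * p) * polyInt (q * q) := by
  have h : ∀ t : ℝ, 0 ≤ polyInt (q * q) * (t * t) + (2 * polyInt (p * q)) * t + polyInt (p * p) := by
    intro t
    have := polyInt_mul_self_nonneg (p + Polynomial.C t * q)
    have e : (p + Polynomial.C t * q) * (p + Polynomial.C t * q)
      = p * p + Polynomial.C (2 * t) * (p * q) + Polynomial.C (t * t) * (q * q) := by
      simp only [map_mul, map_ofNat]; ring
    rw [e, map_add, map_add, polyInt_C_mul, polyInt_C_mul] at this
    linarith
  have := discrim_le_zero h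
  rw [discrim] at this
  nlinarith

/-! ### The Legendre differential operator -/

/-- The differential operator `p ↦ ((3 - X²) p')'`. -/
noncomputable def legendreOp : ℝ[X] →ₗ[ℝ] ℝ[X] :=
  Polynomial.derivative ∘ₗ
    LinearMap.mulLeft ℝ (Polynomial.C 3 - Polynomial.X ^ 2 : ℝ[X]) ∘ₗ Polynomial.derivative

lemma legendreOp_apply (p : ℝ[X]) : legendreOp p =
    Polynomial.derivative ((Polynomial.C 3 - Polynomial.X ^ 2) * Polynomial.derivative p) := rfl

/-- Integration by parts has no boundary terms because the weight `3 - X²` vanishes at `±√3`.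
Symmetry of the operator follows. -/
lemma polyInt_legendreOp_mul (p q : ℝ[X]) : polyInt (legendreOp p * q) =
    -polyInt ((Polynomial.C 3 - Polynomial.X ^ 2) *
      (Polynomial.derivative p * Polynomial.derivative q)) := by
  have h := polyInt_derivative
    (((Polynomial.C 3 - Polynomial.X ^ 2) * Polynomial.derivative p) * q)
  rw [Polynomial.derivative_mul, map_add, ← legendreOp_apply] at h
  have h3 : (√3 : ℝ) ^ 2 = 3 := Real.sq_sqrt (by norm_num)
  simp only [Polynomial.eval_mul, Polynomial.eval_sub, Polynomial.eval_C, Polynomial.eval_pow,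
    Polynomial.eval_X, neg_sq, h3, sub_self, zero_mul] at h
  rw [mul_assoc] at h
  linarith

lemma polyInt_legendreOp_symm (p q : ℝ[X]) :
    polyInt (legendreOp p * q) = polyInt (p * legendreOp q) := by
  rw [polyInt_legendreOp_mul, mul_comm p, polyInt_legendreOp_mul, mul_comm (Polynomial.derivative p)]

lemma legendreOp_eq (p : ℝ[X]) : legendreOp p =
    Polynomial.C 3 * Polynomial.derivative (Polynomial.derivative p)
      - (Polynomial.derivative (Polynomial.derivative p) * Polynomial.X ^ 2
        + Polynomial.C 2 * (Polynomial.derivative p * Polynomial.X)) := by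
  rw [legendreOp_apply]
  simp only [Polynomial.derivative_mul, Polynomial.derivative_sub, Polynomial.derivative_C,
    Polynomial.derivative_X_pow]
  simp
  ring

/-- The operator is triangular in the monomial basis: it preserves degree bounds, and its diagonal
entries `-k(k + 1)` are the eigenvalues. -/
lemma coeff_legendreOp (p : ℝ[X]) (k : ℕ) : (legendreOp p).coeff k =
    3 * ((k + 1) * (k + 2)) * p.coeff (k + 2) - k * (k + 1) * p.coeff k := by
  rw [legendreOp_eq]
  simp only [Polynomial.coeff_sub, Polynomial.coeff_add, Polynomial.coeff_C_mul]
  rcases k with _ | _ | k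
  · simp [Polynomial.coeff_derivative]
    ring
  · rw [zero_add, Polynomial.coeff_mul_X_pow', Polynomial.coeff_mul_X]
    simp [Polynomial.coeff_derivative]
    ring
  · rw [show k + 1 + 1 = k + 2 from rfl, Polynomial.coeff_mul_X_pow,
      show k + 2 = (k + 1) + 1 from rfl, Polynomial.coeff_mul_X]
    simp [Polynomial.coeff_derivative]
    ring

lemma degree_legendreOp_lt {p : ℝ[X]} {k : ℕ} (h : p.degree < k) : (legendreOp p).degree < k := by
  rw [Polynomial.degree_lt_iff_coeff_zero] at h ⊢
  intro m hm
  rw [coeff_legendreOp, h m hm, h (m + 2) (by omega)]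
  simp


/-! ### Orthogonal families -/

section Family

variable {Φ : ℕ → ℝ[X]}

lemma sqNorm_eq_polyInt (i : ℕ) : sqNorm Φ i = polyInt (Φ i * Φ i) := by
  simp [sqNorm, polyInt_apply, sq]

namespace IsOrthogonalFamily

lemma ne_zero (hΦ : IsOrthogonalFamily Φ) (k : ℕ) : Φ k ≠ 0 := fun h => by
  have := hΦ.1 k
  simp [h] at this

lemma sqNorm_pos (hΦ : IsOrthogonalFamily Φ) (k : ℕ) : 0 < sqNorm Φ k := by
  rw [sqNorm_eq_polyInt]
  exact polyInt_mul_self_pos (hΦ.ne_zero k)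

lemma polyInt_mul_of_ne (hΦ : IsOrthogonalFamily Φ) {i j : ℕ} (h : i ≠ j) :
    polyInt (Φ i * Φ j) = 0 := by
  simpa [polyInt_apply] using hΦ.2 i j h

lemma coeff_ne_zero (hΦ : IsOrthogonalFamily Φ) (k : ℕ) : (Φ k).coeff k ≠ 0 :=
  Polynomial.coeff_ne_zero_of_eq_degree (hΦ.1 k)

/-- Every polynomial of degree at most `k` is a multiple of `Φ k` plus one of lower degree. -/
lemma exists_eq_add (hΦ : IsOrthogonalFamily Φ) {k : ℕ} {p : ℝ[X]} (hp : p.degree < (k + 1 : ℕ)) :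
    ∃ (c : ℝ) (q : ℝ[X]), q.degree < k ∧ p = Polynomial.C c * Φ k + q := by
  refine ⟨p.coeff k / (Φ k).coeff k, p - Polynomial.C (p.coeff k / (Φ k).coeff k) * Φ k, ?_,
    by ring⟩
  have hk := hΦ.1 k
  rw [Polynomial.degree_lt_iff_coeff_zero] at hp ⊢
  intro m hm
  rw [Polynomial.coeff_sub, Polynomial.coeff_C_mul]
  rcases hm.eq_or_lt with rfl | hm
  · field_simp [hΦ.coeff_ne_zero k]
    simp
  · rw [hp m hm, Polynomial.coeff_eq_zero_of_degree_lt (p := Φ k) (n := m) (by rw [hk]; exact_mod_cast hm)]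
    simp

lemma polyInt_mul_of_degree_lt (hΦ : IsOrthogonalFamily Φ) {j k : ℕ} (hjk : j ≤ k) {q : ℝ[X]}
    (hq : q.degree < j) : polyInt (Φ k * q) = 0 := by
  induction j generalizing q with
  | zero =>
    have : q = 0 := by simpa [Polynomial.degree_lt_iff_coeff_zero, Polynomial.ext_iff] using hq
    simp [this]
  | succ j ih =>
    obtain ⟨c, r, hr, rfl⟩ := hΦ.exists_eq_add hq
    rw [mul_add, map_add, ih (by omega) hr, mul_left_comm, polyInt_C_mul,
      hΦ.polyInt_mul_of_ne (by omega)]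
    simp

/-- Legendre's equation. The leading terms cancel, so the defect `r` has degree below `k`. By
symmetry, pairing `r` with itself only pairs `Φ k` with `legendreOp r` and `r`, both of degree below
`k`, so `r = 0`. -/
lemma legendreOp_eq (hΦ : IsOrthogonalFamily Φ) (k : ℕ) :
    legendreOp (Φ k) = Polynomial.C (-(k * (k + 1) : ℝ)) * Φ k := by
  set r := legendreOp (Φ k) - Polynomial.C (-(k * (k + 1) : ℝ)) * Φ k with hr
  have hdeg : r.degree < k := by
    rw [Polynomial.degree_lt_iff_coeff_zero]
    intro m hm
    have h2 : ∀ i, k < i → (Φ k).coeff i = 0 := fun i hi =>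
      Polynomial.coeff_eq_zero_of_degree_lt (by rw [hΦ.1 k]; exact_mod_cast hi)
    rw [hr, Polynomial.coeff_sub, Polynomial.coeff_C_mul, coeff_legendreOp, h2 (m + 2) (by omega)]
    rcases hm.eq_or_lt with rfl | hm
    · ring
    · rw [h2 m hm]; ring
  have h0 : polyInt (r * r) = 0 := by
    calc polyInt (r * r)
        = polyInt (legendreOp (Φ k) * r) - polyInt (Polynomial.C (-(k * (k + 1) : ℝ)) * (Φ k * r)) := by
          rw [← map_sub, ← mul_assoc, ← sub_mul, ← hr]
      _ = 0 := by
          rw [polyInt_legendreOp_symm, polyInt_C_mul,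
            hΦ.polyInt_mul_of_degree_lt le_rfl (degree_legendreOp_lt hdeg),
            hΦ.polyInt_mul_of_degree_lt le_rfl hdeg]
          simp
  exact sub_eq_zero.1 (eq_zero_of_polyInt_mul_self h0)

/-- The weighted Poincaré inequality on the complement of the polynomials of degree at most `N`. -/
lemma le_polyInt_weighted (hΦ : IsOrthogonalFamily Φ) {N : ℕ} (M : ℕ) {p : ℝ[X]}
    (hp : p.degree < M) (horth : ∀ q : ℝ[X], q.degree < (N + 1 : ℕ) → polyInt (p * q) = 0) :
    ((N + 1) * (N + 2) : ℝ) * polyInt (p * p) ≤ -polyInt (legendreOp p * p) := by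
  induction M generalizing p with
  | zero =>
    have : p = 0 := by simpa [Polynomial.degree_lt_iff_coeff_zero, Polynomial.ext_iff] using hp
    simp [this]
  | succ M ih =>
    by_cases hMN : M ≤ N
    · have : p = 0 := eq_zero_of_polyInt_mul_self (horth p (hp.trans_le (by exact_mod_cast (by omega))))
      simp [this]
    obtain ⟨c, r, hr, rfl⟩ := hΦ.exists_eq_add hp
    have hr' : ∀ q : ℝ[X], q.degree < (N + 1 : ℕ) → polyInt (r * q) = 0 := by
      intro q hq
      have := horth q hq
      rwa [add_mul, map_add, mul_assoc, polyInt_C_mul,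
        hΦ.polyInt_mul_of_degree_lt (by omega : N + 1 ≤ M) hq, mul_zero, zero_add] at this
    have key := ih hr hr'
    have e1 : polyInt (Φ M * r) = 0 := hΦ.polyInt_mul_of_degree_lt le_rfl hr
    have e2 : polyInt (Φ M * legendreOp r) = 0 :=
      hΦ.polyInt_mul_of_degree_lt le_rfl (degree_legendreOp_lt hr)
    -- `Φ M` is an eigenvector orthogonal to `r` and to `legendreOp r`, so both quadratic forms
    -- split without cross terms. The new eigenvalue `M(M + 1)` is at least `(N + 1)(N + 2)` as `M >
    -- N`.
    have e3 : polyInt ((Polynomial.C c * Φ M + r) * (Polynomial.C c * Φ M + r))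
        = c ^ 2 * polyInt (Φ M * Φ M) + polyInt (r * r) := by
      have : (Polynomial.C c * Φ M + r) * (Polynomial.C c * Φ M + r) =
        Polynomial.C (c ^ 2) * (Φ M * Φ M) + Polynomial.C (2 * c) * (Φ M * r) + r * r := by
        simp only [map_mul, map_ofNat, map_pow]; ring
      rw [this, map_add, map_add, polyInt_C_mul, polyInt_C_mul, e1]; ring
    have e4 : polyInt (legendreOp (Polynomial.C c * Φ M + r) * (Polynomial.C c * Φ M + r))
        = -(c ^ 2 * (M * (M + 1)) * polyInt (Φ M * Φ M)) + polyInt (legendreOp r * r) := by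
      have e5 : legendreOp (Polynomial.C c * Φ M) =
          Polynomial.C c * (Polynomial.C (-(M * (M + 1) : ℝ)) * Φ M) := by
        rw [← Polynomial.smul_eq_C_mul, map_smul, hΦ.legendreOp_eq M, Polynomial.smul_eq_C_mul]
      rw [map_add, e5]
      have : (Polynomial.C c * (Polynomial.C (-(M * (M + 1) : ℝ)) * Φ M) + legendreOp r) *
          (Polynomial.C c * Φ M + r) =
        Polynomial.C (-(c ^ 2 * (M * (M + 1)))) * (Φ M * Φ M)
          + Polynomial.C (-(c * (M * (M + 1)))) * (Φ M * r)
          + Polynomial.C c * (Φ M * legendreOp r) + legendreOp r * r := by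
        simp only [map_mul, map_neg, map_pow]; ring
      rw [this, map_add, map_add, map_add, polyInt_C_mul, polyInt_C_mul, polyInt_C_mul, e1, e2]; ring
    rw [e3, e4]
    have hM : ((N + 1) * (N + 2) : ℝ) ≤ M * (M + 1) := by
      have : (N + 1 : ℝ) ≤ M := by exact_mod_cast (by omega : N + 1 ≤ M)
      nlinarith
    have := mul_le_mul_of_nonneg_right hM
      (mul_nonneg (sq_nonneg c) (polyInt_mul_self_nonneg (Φ M)))
    nlinarith

/-- Integrate the derivative of `X Φ_k²`, which is `(2k + 1) Φ_k² + 2 Φ_k (X Φ_k' - k Φ_k)`. In the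
last bracket the leading terms cancel, so it is orthogonal to `Φ_k`. -/
lemma sqNorm_mul (hΦ : IsOrthogonalFamily Φ) (k : ℕ) : (2 * k + 1) * sqNorm Φ k =
    √3 * ((Φ k).eval √3 ^ 2 + (Φ k).eval (-√3) ^ 2) := by
  have h := polyInt_derivative (Polynomial.X * (Φ k * Φ k))
  have hd : Polynomial.derivative (Polynomial.X * (Φ k * Φ k)) =
      Polynomial.C (2 * k + 1 : ℝ) * (Φ k * Φ k) + Polynomial.C 2 *
      (Φ k * (Polynomial.X * Polynomial.derivative (Φ k) - Polynomial.C (k : ℝ) * Φ k)) := by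
    simp only [Polynomial.derivative_mul, Polynomial.derivative_X, map_add, map_mul, map_ofNat,
      map_one]
    ring
  have hdeg : (Polynomial.X * Polynomial.derivative (Φ k) - Polynomial.C (k : ℝ) * Φ k).degree
      < (k : WithBot ℕ) := by
    rw [Polynomial.degree_lt_iff_coeff_zero]
    intro m hm
    have h2 : ∀ i, k < i → (Φ k).coeff i = 0 := fun i hi =>
      Polynomial.coeff_eq_zero_of_degree_lt (by rw [hΦ.1 k]; exact_mod_cast hi)
    rw [Polynomial.coeff_sub, Polynomial.coeff_C_mul]
    rcases m with _ | m
    · obtain rfl : k = 0 := by omega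
      simp
    · rw [Polynomial.coeff_X_mul, Polynomial.coeff_derivative]
      rcases hm.eq_or_lt with rfl | hm
      · push_cast; ring
      · rw [h2 _ hm]; ring
  rw [hd, map_add, polyInt_C_mul, polyInt_C_mul, hΦ.polyInt_mul_of_degree_lt le_rfl hdeg,
    ← sqNorm_eq_polyInt] at h
  simp only [Polynomial.eval_mul, Polynomial.eval_X] at h
  linarith

/-- On `Ixi`, `(Φ k)²` is controlled by its values at the end points (monotonicity of the Sonin
function). -/
lemma eval_sq_le_endpoints (hΦ : IsOrthogonalFamily Φ) (k : ℕ) {x : ℝ} (hx : x ∈ Ixi) :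
    (Φ k).eval x ^ 2 ≤ (Φ k).eval √3 ^ 2 + (Φ k).eval (-√3) ^ 2 := by
  rcases Nat.eq_zero_or_pos k with rfl | hk
  · obtain ⟨c, hc⟩ : ∃ c, Φ 0 = Polynomial.C c :=
      ⟨_, Polynomial.eq_C_of_degree_le_zero (by simpa using (hΦ.1 0).le)⟩
    simp [hc]; positivity
  have hkk : (0 : ℝ) < k * (k + 1) := by positivity
  -- By Legendre's equation `S' = 2 X (Φ_k')²`, so `S` grows away from the origin. It dominates `k(k
  -- + 1) Φ_k²`, with equality at the end points. The case `k = 0` is separate because this factor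
  -- is cancelled.
  set S : ℝ[X] := Polynomial.C (k * (k + 1) : ℝ) * Φ k ^ 2 +
    (Polynomial.C 3 - Polynomial.X ^ 2) * Polynomial.derivative (Φ k) ^ 2 with hS
  have hder : Polynomial.derivative S =
      Polynomial.C 2 * Polynomial.X * Polynomial.derivative (Φ k) ^ 2 := by
    have h := hΦ.legendreOp_eq k
    rw [legendreOp_apply, Polynomial.derivative_mul] at h
    rw [hS]
    simp only [Polynomial.derivative_mul, Polynomial.derivative_add, Polynomial.derivative_sub,
      Polynomial.derivative_C, Polynomial.derivative_pow, Polynomial.derivative_X] at h ⊢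
    simp only [map_neg, map_mul, map_ofNat, Nat.cast_ofNat, zero_sub, zero_mul, zero_add,
      Nat.add_one_sub_one, pow_one, mul_one] at h ⊢
    linear_combination 2 * Polynomial.derivative (Φ k) * h
  have hend : ∀ y : ℝ, y ^ 2 = 3 → S.eval y = k * (k + 1) * (Φ k).eval y ^ 2 := by
    intro y hy
    simp [hS, hy]
  have hmid : k * (k + 1) * (Φ k).eval x ^ 2 ≤ S.eval x := by
    have h1 : x ^ 2 ≤ 3 := by
      have := abs_le.2 hx
      calc x ^ 2 = |x| ^ 2 := (sq_abs x).symm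
        _ ≤ √3 ^ 2 := by gcongr
        _ = 3 := Real.sq_sqrt (by norm_num)
    simp only [hS, Polynomial.eval_add, Polynomial.eval_mul, Polynomial.eval_C,
      Polynomial.eval_pow, Polynomial.eval_sub, Polynomial.eval_X]
    have : 0 ≤ (3 - x ^ 2) * (Polynomial.derivative (Φ k)).eval x ^ 2 :=
      mul_nonneg (by linarith) (sq_nonneg _)
    linarith
  have h3 : (√3 : ℝ) ^ 2 = 3 := Real.sq_sqrt (by norm_num)
  rcases le_total 0 x with h0 | h0
  · have hmono : MonotoneOn (fun y => S.eval y) (Ici 0) := by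
      refine monotoneOn_of_deriv_nonneg (convex_Ici 0) S.continuous.continuousOn
        S.differentiable.differentiableOn fun y hy => ?_
      rw [interior_Ici] at hy
      rw [Polynomial.deriv, hder]
      simp only [Polynomial.eval_mul, Polynomial.eval_C, Polynomial.eval_X, Polynomial.eval_pow]
      have : (0 : ℝ) ≤ y := le_of_lt hy
      positivity
    have := hmono h0 sqrt_three_pos.le hx.2
    simp only [hend √3 h3] at this
    have := le_of_mul_le_mul_left (hmid.trans this) hkk
    nlinarith [sq_nonneg ((Φ k).eval (-√3))]
  · have hmono : AntitoneOn (fun y => S.eval y) (Iic 0) := by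
      refine antitoneOn_of_deriv_nonpos (convex_Iic 0) S.continuous.continuousOn
        S.differentiable.differentiableOn fun y hy => ?_
      rw [interior_Iic] at hy
      rw [Polynomial.deriv, hder]
      simp only [Polynomial.eval_mul, Polynomial.eval_C, Polynomial.eval_X, Polynomial.eval_pow]
      have : y ≤ (0 : ℝ) := le_of_lt hy
      exact mul_nonpos_of_nonpos_of_nonneg (by linarith) (sq_nonneg _)
    have := hmono (show -√3 ∈ Iic (0 : ℝ) by simp) h0 hx.1
    simp only [hend (-√3) (by rw [neg_sq, h3])] at this
    have := le_of_mul_le_mul_left (hmid.trans this) hkk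
    nlinarith [sq_nonneg ((Φ k).eval √3)]

lemma eval_sq_le (hΦ : IsOrthogonalFamily Φ) (k : ℕ) {x : ℝ} (hx : x ∈ Ixi) :
    (Φ k).eval x ^ 2 ≤ (2 * k + 1) * sqNorm Φ k := by
  rw [hΦ.sqNorm_mul]
  have h := hΦ.eval_sq_le_endpoints k hx
  nlinarith [one_le_sqrt_three, sq_nonneg ((Φ k).eval √3), sq_nonneg ((Φ k).eval (-√3))]

lemma sum_eval_sq_div_le (hΦ : IsOrthogonalFamily Φ) (N : ℕ) {x : ℝ} (hx : x ∈ Ixi) :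
    ∑ k ∈ Finset.range (N + 1), (Φ k).eval x ^ 2 / sqNorm Φ k ≤ ((N : ℝ) + 1) ^ 2 := by
  induction N with
  | zero =>
    simp only [zero_add, Finset.sum_range_one]
    rw [div_le_iff₀ (hΦ.sqNorm_pos 0)]
    simpa using hΦ.eval_sq_le 0 hx
  | succ N ih =>
    rw [Finset.sum_range_succ]
    have : (Φ (N + 1)).eval x ^ 2 / sqNorm Φ (N + 1) ≤ 2 * (N + 1 : ℕ) + 1 :=
      (div_le_iff₀ (hΦ.sqNorm_pos _)).2 (hΦ.eval_sq_le _ hx)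
    push_cast at this ⊢
    nlinarith

end IsOrthogonalFamily

end Family


/-! ### The scalar orthogonal projection -/

section Projection

variable {Φ : ℕ → ℝ[X]}

/-- The orthogonal projection of `v` onto the span of `Φ 0, …, Φ N`, as a polynomial. -/
noncomputable def scalarProj (Φ : ℕ → ℝ[X]) (N : ℕ) (v : ℝ → ℝ) : ℝ[X] :=
  ∑ k ∈ Finset.range (N + 1),
    Polynomial.C ((sqNorm Φ k)⁻¹ * ∫ z, (Φ k).eval z * v z ∂lebXi) * Φ k

/-- The orthogonal projection of a polynomial. -/
noncomputable abbrev polyProj (Φ : ℕ → ℝ[X]) (N : ℕ) (p : ℝ[X]) : ℝ[X] :=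
  scalarProj Φ N fun z => p.eval z

lemma scalarProj_sub (N : ℕ) {v w : ℝ → ℝ} (hv : ContinuousOn v Ixi) (hw : ContinuousOn w Ixi) :
    scalarProj Φ N (fun z => v z - w z) = scalarProj Φ N v - scalarProj Φ N w := by
  simp only [scalarProj, ← Finset.sum_sub_distrib, ← sub_mul, ← map_sub, ← mul_sub]
  refine Finset.sum_congr rfl fun k _ => ?_
  simp only [mul_sub (Polynomial.eval _ _)]
  rw [integral_sub]
  · exact integrable_lebXi_of_continuousOn ((Φ k).continuous.continuousOn.mul hv)
  · exact integrable_lebXi_of_continuousOn ((Φ k).continuous.continuousOn.mul hw)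

lemma polyProj_sub (N : ℕ) (p q : ℝ[X]) :
    polyProj Φ N (p - q) = polyProj Φ N p - polyProj Φ N q := by
  simp only [polyProj, Polynomial.eval_sub]
  exact scalarProj_sub N p.continuous.continuousOn q.continuous.continuousOn

lemma polyProj_eq (N : ℕ) (p : ℝ[X]) : polyProj Φ N p = ∑ k ∈ Finset.range (N + 1),
    Polynomial.C ((sqNorm Φ k)⁻¹ * polyInt (Φ k * p)) * Φ k := by
  simp [scalarProj, polyInt_apply]

namespace IsOrthogonalFamily

lemma degree_scalarProj_lt (hΦ : IsOrthogonalFamily Φ) (N : ℕ) (v : ℝ → ℝ) :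
    (scalarProj Φ N v).degree < (N + 1 : ℕ) := by
  rw [Polynomial.degree_lt_iff_coeff_zero]
  intro m hm
  rw [scalarProj, Polynomial.finsetSum_coeff]
  refine Finset.sum_eq_zero fun k hk => ?_
  rw [Polynomial.coeff_C_mul, Polynomial.coeff_eq_zero_of_degree_lt (p := Φ k) (n := m), mul_zero]
  rw [hΦ.1 k]
  have := Finset.mem_range.1 hk
  exact_mod_cast (by omega : k < m)

lemma polyInt_polyProj_mul (hΦ : IsOrthogonalFamily Φ) {N j : ℕ} (hj : j < N + 1) (p : ℝ[X]) :
    polyInt (polyProj Φ N p * Φ j) = polyInt (p * Φ j) := by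
  rw [polyProj_eq, Finset.sum_mul, map_sum, Finset.sum_eq_single j]
  · rw [mul_assoc, polyInt_C_mul, ← sqNorm_eq_polyInt, mul_comm p]
    field_simp [(hΦ.sqNorm_pos j).ne']
  · intro k _ hk
    rw [mul_assoc, polyInt_C_mul, hΦ.polyInt_mul_of_ne hk, mul_zero]
  · intro h
    exact absurd (Finset.mem_range.2 hj) h

lemma polyInt_sub_polyProj_mul (hΦ : IsOrthogonalFamily Φ) {N : ℕ} (p : ℝ[X]) {q : ℝ[X]}
    (hq : q.degree < (N + 1 : ℕ)) : polyInt ((p - polyProj Φ N p) * q) = 0 := by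
  suffices h : ∀ j ≤ N + 1, ∀ q : ℝ[X], q.degree < j → polyInt ((p - polyProj Φ N p) * q) = 0 from
    h _ le_rfl q hq
  intro j
  induction j with
  | zero =>
    intro _ q hq
    have : q = 0 := by simpa [Polynomial.degree_lt_iff_coeff_zero, Polynomial.ext_iff] using hq
    simp [this]
  | succ j ih =>
    intro hj q hq
    obtain ⟨c, r, hr, rfl⟩ := hΦ.exists_eq_add hq
    rw [mul_add, map_add, ih (by omega) r hr, mul_left_comm, polyInt_C_mul, sub_mul, map_sub,
      hΦ.polyInt_polyProj_mul (by omega)]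
    simp

lemma polyProj_eq_self (hΦ : IsOrthogonalFamily Φ) {N : ℕ} {q : ℝ[X]}
    (hq : q.degree < (N + 1 : ℕ)) : polyProj Φ N q = q := by
  refine (sub_eq_zero.1 (eq_zero_of_polyInt_mul_self (hΦ.polyInt_sub_polyProj_mul q ?_))).symm
  exact (Polynomial.degree_sub_le _ _).trans_lt (max_lt hq (hΦ.degree_scalarProj_lt N _))

lemma polyInt_pythagoras (hΦ : IsOrthogonalFamily Φ) (N : ℕ) (p : ℝ[X]) :
    polyInt (p * p) = polyInt (polyProj Φ N p * polyProj Φ N p) +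
      polyInt ((p - polyProj Φ N p) * (p - polyProj Φ N p)) := by
  have h := hΦ.polyInt_sub_polyProj_mul p (hΦ.degree_scalarProj_lt N fun z => p.eval z)
  have : p * p = polyProj Φ N p * polyProj Φ N p +
      (p - polyProj Φ N p) * (p - polyProj Φ N p) +
      Polynomial.C 2 * ((p - polyProj Φ N p) * polyProj Φ N p) := by
    simp only [map_ofNat]; ring
  conv_lhs => rw [this]
  rw [map_add, map_add, polyInt_C_mul, h]
  ring

/-- Nikolskii's inequality between the maximum and the `L²` norm. -/
lemma eval_sq_le_polyInt (hΦ : IsOrthogonalFamily Φ) {N : ℕ} {q : ℝ[X]}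
    (hq : q.degree < (N + 1 : ℕ)) {x : ℝ} (hx : x ∈ Ixi) :
    q.eval x ^ 2 ≤ ((N : ℝ) + 1) ^ 2 * polyInt (q * q) := by
  set c : ℕ → ℝ := fun k => (sqNorm Φ k)⁻¹ * polyInt (Φ k * q) with hc
  have hqe : q = ∑ k ∈ Finset.range (N + 1), Polynomial.C (c k) * Φ k := by
    conv_lhs => rw [← hΦ.polyProj_eq_self hq, polyProj_eq]
  have hI : polyInt (q * q) = ∑ k ∈ Finset.range (N + 1), c k ^ 2 * sqNorm Φ k := by
    conv_lhs => rw [show q * q = (∑ k ∈ Finset.range (N + 1), Polynomial.C (c k) * Φ k) * q by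
      rw [← hqe]]
    rw [Finset.sum_mul, map_sum]
    refine Finset.sum_congr rfl fun k _ => ?_
    rw [mul_assoc, polyInt_C_mul, hc]
    field_simp [(hΦ.sqNorm_pos k).ne']
  have hx2 : q.eval x = ∑ k ∈ Finset.range (N + 1),
      (c k * √(sqNorm Φ k)) * ((Φ k).eval x / √(sqNorm Φ k)) := by
    conv_lhs => rw [hqe]
    rw [Polynomial.eval_finsetSum]
    refine Finset.sum_congr rfl fun k _ => ?_
    have := (Real.sqrt_pos.2 (hΦ.sqNorm_pos k)).ne'
    rw [Polynomial.eval_mul, Polynomial.eval_C]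
    field_simp
  rw [hx2, hI, mul_comm]
  refine (Finset.sum_mul_sq_le_sq_mul_sq _ _ _).trans ?_
  have e1 : ∀ k, (c k * √(sqNorm Φ k)) ^ 2 = c k ^ 2 * sqNorm Φ k := fun k => by
    rw [mul_pow, Real.sq_sqrt (hΦ.sqNorm_pos k).le]
  have e2 : ∀ k, ((Φ k).eval x / √(sqNorm Φ k)) ^ 2 = (Φ k).eval x ^ 2 / sqNorm Φ k := fun k => by
    rw [div_pow, Real.sq_sqrt (hΦ.sqNorm_pos k).le]
  simp only [e1, e2]
  exact mul_le_mul_of_nonneg_left (hΦ.sum_eval_sq_div_le N hx)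
    (Finset.sum_nonneg fun k _ => mul_nonneg (sq_nonneg _) (hΦ.sqNorm_pos k).le)

/-- The `L²` error of the projection is controlled by the derivative. -/
lemma polyInt_sub_polyProj_sq_le (hΦ : IsOrthogonalFamily Φ) (N : ℕ) (p : ℝ[X]) :
    ((N + 1) * (N + 2) : ℝ) * polyInt ((p - polyProj Φ N p) * (p - polyProj Φ N p)) ≤
      3 * polyInt (Polynomial.derivative p * Polynomial.derivative p) := by
  set s := polyProj Φ N p with hs
  set r := p - s with hr
  have hsdeg : s.degree < (N + 1 : ℕ) := hΦ.degree_scalarProj_lt N _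
  obtain ⟨M, hM⟩ : ∃ M : ℕ, r.degree < M :=
    ⟨r.natDegree + 1, Polynomial.degree_le_natDegree.trans_lt (by exact_mod_cast Nat.lt_succ_self _)⟩
  have h1 := hΦ.le_polyInt_weighted M hM fun q hq => hΦ.polyInt_sub_polyProj_mul p hq
  have h2 : -polyInt (legendreOp p * p) =
      -polyInt (legendreOp r * r) - polyInt (legendreOp s * s) := by
    -- The residual `r` is orthogonal to `legendreOp s`, which has degree at most `N`. The weighted
    -- energy of `p` is therefore the sum of those of `r` and `s`; the latter is dropped, and the
    -- weight is bounded by `3`.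
    have e1 : polyInt (r * legendreOp s) = 0 :=
      hΦ.polyInt_sub_polyProj_mul p (degree_legendreOp_lt hsdeg)
    have e2 : polyInt (legendreOp r * s) = 0 := by rw [polyInt_legendreOp_symm, e1]
    have : p = r + s := by rw [hr]; ring
    rw [this, map_add, show (legendreOp r + legendreOp s) * (r + s) =
      legendreOp r * r + legendreOp r * s + r * legendreOp s + legendreOp s * s by ring,
      map_add, map_add, map_add, e1, e2]
    ring
  have hW : ∀ z ∈ Ixi, 0 ≤ 3 - z ^ 2 := fun z hz => by
    have : z ^ 2 ≤ 3 := by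
      have := abs_le.2 hz
      calc z ^ 2 = |z| ^ 2 := (sq_abs z).symm
        _ ≤ √3 ^ 2 := by gcongr
        _ = 3 := Real.sq_sqrt (by norm_num)
    linarith
  have h3 : 0 ≤ -polyInt (legendreOp s * s) := by
    rw [polyInt_legendreOp_mul, neg_neg]
    refine polyInt_nonneg fun z hz => ?_
    simpa using mul_nonneg (hW z hz) (mul_self_nonneg _)
  have h4 : -polyInt (legendreOp p * p) ≤
      3 * polyInt (Polynomial.derivative p * Polynomial.derivative p) := by
    rw [polyInt_legendreOp_mul, neg_neg, ← polyInt_C_mul]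
    refine polyInt_mono fun z _ => ?_
    simp only [Polynomial.eval_mul, Polynomial.eval_sub, Polynomial.eval_C, Polynomial.eval_pow,
      Polynomial.eval_X]
    exact mul_le_mul_of_nonneg_right (by nlinarith [sq_nonneg z]) (mul_self_nonneg _)
  linarith

end IsOrthogonalFamily

lemma exists_derivative_eq (p : ℝ[X]) : ∃ q : ℝ[X], Polynomial.derivative q = p := by
  induction p using Polynomial.induction_on' with
  | add p q hp hq =>
    obtain ⟨P, rfl⟩ := hp
    obtain ⟨Q, rfl⟩ := hq
    exact ⟨P + Q, map_add _ _ _⟩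
  | monomial k a =>
    refine ⟨Polynomial.monomial (k + 1) (a / (k + 1)), ?_⟩
    rw [Polynomial.derivative_monomial]
    have : (k + 1 : ℝ) ≠ 0 := by positivity
    simp [div_mul_cancel₀ a this]

lemma degree_lt_of_derivative {p : ℝ[X]} {k : ℕ} (h : (Polynomial.derivative p).degree < k) :
    p.degree < (k + 1 : ℕ) := by
  rw [Polynomial.degree_lt_iff_coeff_zero] at h ⊢
  intro m hm
  obtain ⟨m, rfl⟩ : ∃ j, m = j + 1 := ⟨m - 1, by omega⟩
  have := h m (by omega)
  rw [Polynomial.coeff_derivative] at this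
  exact (mul_eq_zero.1 this).resolve_right (by positivity)

/-! ### Primitives of square integrable functions and the uniform projection error. -/

lemma intervalIntegrable_of_lebXi {E : Type*} [NormedAddCommGroup E] {h : ℝ → E}
    (hh : Integrable h lebXi) {x : ℝ} (hx : x ∈ Ixi) : IntervalIntegrable h volume (-√3) x := by
  rw [intervalIntegrable_iff_integrableOn_Icc_of_le hx.1]
  exact IntegrableOn.mono_set hh (Icc_subset_Icc le_rfl hx.2)

/-- Cauchy–Schwarz against the constant `1`, through a discriminant in `t`. The interval has length
at most `2√3 ≤ 4`. -/
lemma sq_intervalIntegral_le {h : ℝ → ℝ} (hh : MemLp h 2 lebXi) {x : ℝ} (hx : x ∈ Ixi) :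
    (∫ z in (-√3)..x, h z) ^ 2 ≤ 4 * ∫ z, h z ^ 2 ∂lebXi := by
  have hx0 : 0 ≤ x + √3 := by linarith [hx.1]
  have hI0 : 0 ≤ ∫ z, h z ^ 2 ∂lebXi := integral_nonneg fun z => sq_nonneg _
  have i0 : IntervalIntegrable h volume (-√3) x :=
    intervalIntegrable_of_lebXi (hh.integrable (by norm_num)) hx
  have i1 : IntervalIntegrable (fun z => h z ^ 2) volume (-√3) x :=
    intervalIntegrable_of_lebXi hh.integrable_sq hx
  have hdisc : ∀ t : ℝ, 0 ≤ (x + √3) * (t * t) + (2 * ∫ z in (-√3)..x, h z) * t +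
      ∫ z, h z ^ 2 ∂lebXi := by
    intro t
    have h1 : ∫ z in (-√3)..x, (h z + t) ^ 2 =
        (∫ z in (-√3)..x, h z ^ 2) + 2 * t * (∫ z in (-√3)..x, h z) +
          (x + √3) * (t * t) := by
      have i2 : IntervalIntegrable (fun z => 2 * t * h z) volume (-√3) x := i0.const_mul _
      have i3 : IntervalIntegrable (fun _ : ℝ => t * t) volume (-√3) x :=
        continuous_const.intervalIntegrable _ _
      rw [← intervalIntegral.integral_const_mul, show (x + √3) * (t * t) = ∫ _z in (-√3)..x, t * t by
        rw [intervalIntegral.integral_const, smul_eq_mul, sub_neg_eq_add],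
        ← intervalIntegral.integral_add i1 i2, ← intervalIntegral.integral_add (i1.add i2) i3]
      congr 1; ext z; ring
    have h2 : 0 ≤ ∫ z in (-√3)..x, (h z + t) ^ 2 :=
      intervalIntegral.integral_nonneg hx.1 fun z _ => sq_nonneg _
    have h3 : ∫ z in (-√3)..x, h z ^ 2 ≤ ∫ z, h z ^ 2 ∂lebXi := by
      rw [integral_lebXi]
      exact intervalIntegral.integral_mono_interval le_rfl hx.1 hx.2
        (Filter.Eventually.of_forall fun z => sq_nonneg _)
        (intervalIntegrable_of_lebXi hh.integrable_sq ⟨neg_sqrt_three_le, le_rfl⟩)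
    linarith
  have := discrim_le_zero hdisc
  rw [discrim] at this
  have h4 : x + √3 ≤ 4 := by linarith [hx.2, sqrt_three_le]
  have h5 := mul_le_mul_of_nonneg_right h4 hI0
  nlinarith

lemma memLp_of_continuousOn {E : Type*} [NormedAddCommGroup E] {v : ℝ → E}
    (hv : ContinuousOn v Ixi) (p : ℝ≥0∞) : MemLp v p lebXi := by
  obtain ⟨C, hC⟩ := isCompact_Icc.exists_bound_of_continuousOn hv
  exact MemLp.of_bound (hv.aestronglyMeasurable_of_isCompact isCompact_Icc measurableSet_Icc) C
    (ae_mem_Ixi.mono hC)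

/-- The projection of a polynomial is accurate in the maximum norm, in terms of its derivative. -/
lemma IsOrthogonalFamily.eval_sub_polyProj_sq_le (hΦ : IsOrthogonalFamily Φ) (N : ℕ) (p : ℝ[X])
    {x : ℝ} (hx : x ∈ Ixi) : (p - polyProj Φ (N + 1) p).eval x ^ 2 ≤
      20 * polyInt (Polynomial.derivative p * Polynomial.derivative p) := by
  -- The comparison polynomial `q` is the primitive of the projected derivative that agrees with `p`
  -- at the left end. Its degree is at most `N + 1`, so the projection of order `N + 1` reproduces
  -- it.
  obtain ⟨q₀, hq₀⟩ := exists_derivative_eq (polyProj Φ N (Polynomial.derivative p))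
  set q := q₀ + Polynomial.C (p.eval (-√3) - q₀.eval (-√3)) with hq
  have hq' : Polynomial.derivative q = polyProj Φ N (Polynomial.derivative p) := by
    rw [hq, map_add, Polynomial.derivative_C, add_zero, hq₀]
  set e := p - q with he
  have he' : Polynomial.derivative e =
      Polynomial.derivative p - polyProj Φ N (Polynomial.derivative p) := by
    rw [he, map_sub, hq']
  have hqdeg : q.degree < (N + 1 + 1 : ℕ) :=
    degree_lt_of_derivative (by rw [hq']; exact hΦ.degree_scalarProj_lt N _)
  have he0 : e.eval (-√3) = 0 := by simp [he, hq]
  -- `e'` is a projection residual, hence orthogonal to constants, so `e` has equal end values.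
  have he1 : e.eval √3 = 0 := by
    have h1 := polyInt_derivative e
    have h2 := hΦ.polyInt_sub_polyProj_mul (N := N) (Polynomial.derivative p) (q := 1)
      (by rw [Polynomial.degree_one]; exact_mod_cast Nat.succ_pos N)
    rw [mul_one, ← he', h1, he0] at h2
    linarith
  set E := polyInt (Polynomial.derivative e * Polynomial.derivative e) with hE
  have hE0 : 0 ≤ E := polyInt_mul_self_nonneg _
  have hEp : E ≤ polyInt (Polynomial.derivative p * Polynomial.derivative p) := by
    have h := hΦ.polyInt_pythagoras N (Polynomial.derivative p)
    rw [← he'] at h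
    have := polyInt_mul_self_nonneg (polyProj Φ N (Polynomial.derivative p))
    linarith
  have hsup : e.eval x ^ 2 ≤ 4 * E := by
    have h := sq_intervalIntegral_le
      (memLp_of_continuousOn (Polynomial.derivative e).continuous.continuousOn 2) hx
    simp only [← Polynomial.eval_pow, sq (Polynomial.derivative e), ← polyInt_apply] at h
    rwa [intervalIntegral.integral_eq_sub_of_hasDerivAt (fun y _ => e.hasDerivAt y)
      ((Polynomial.derivative e).continuous.intervalIntegrable _ _), he0, sub_zero] at h
  -- Duality argument: with `ψ' = e` and `e` zero at both ends, `‖e‖² = -∫ e' ψ`. Since `e'` is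
  -- orthogonal to degree at most `N`, `ψ` may be replaced by its projection residual, which is
  -- small in terms of `‖ψ'‖ = ‖e‖`.
  have hL2 : ((N + 1) * (N + 2) : ℝ) * polyInt (e * e) ≤ 3 * E := by
    obtain ⟨ψ, hψ⟩ := exists_derivative_eq e
    set r := ψ - polyProj Φ N ψ with hr
    have h1 : polyInt (e * e) = -polyInt (Polynomial.derivative e * r) := by
      have h := polyInt_derivative (e * ψ)
      rw [Polynomial.derivative_mul, map_add, hψ, Polynomial.eval_mul, Polynomial.eval_mul,
        he0, he1] at h
      have h2 : polyInt (Polynomial.derivative e * polyProj Φ N ψ) = 0 := by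
        rw [he']
        exact hΦ.polyInt_sub_polyProj_mul _ (hΦ.degree_scalarProj_lt N _)
      rw [hr, mul_sub _ ψ, map_sub, h2]
      linarith
    have h2 := polyInt_mul_sq_le (Polynomial.derivative e) r
    have h3 := hΦ.polyInt_sub_polyProj_sq_le N ψ
    rw [hψ, ← hr] at h3
    have h4 : polyInt (e * e) ^ 2 ≤ E * polyInt (r * r) := by rw [h1, neg_sq]; exact h2
    rcases (polyInt_mul_self_nonneg e).eq_or_lt with h0 | h0
    · rw [← h0]; linarith
    · have hn : (0 : ℝ) ≤ (N + 1) * (N + 2) := by positivity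
      have h5 : ((N + 1) * (N + 2) : ℝ) * polyInt (e * e) * polyInt (e * e) ≤
          3 * E * polyInt (e * e) := by
        have a1 := mul_le_mul_of_nonneg_left h4 hn
        have a2 := mul_le_mul_of_nonneg_left h3 hE0
        nlinarith
      exact le_of_mul_le_mul_right h5 h0
  -- Nikolskii costs `(N + 2)²` and `hL2` gains `(N + 1)(N + 2)`; their ratio is at most `2`, hence
  -- `2 · 3 = 6`.
  have hproj : (polyProj Φ (N + 1) e).eval x ^ 2 ≤ 6 * E := by
    have h1 := hΦ.eval_sq_le_polyInt (hΦ.degree_scalarProj_lt (N + 1) fun z => e.eval z) hx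
    have h2 : polyInt (polyProj Φ (N + 1) e * polyProj Φ (N + 1) e) ≤ polyInt (e * e) := by
      have h := hΦ.polyInt_pythagoras (N + 1) e
      have := polyInt_mul_self_nonneg (e - polyProj Φ (N + 1) e)
      linarith
    have h3 : (((N + 1 : ℕ) : ℝ) + 1) ^ 2 ≤ 2 * ((N + 1) * (N + 2)) := by
      push_cast; nlinarith [(Nat.cast_nonneg N : (0 : ℝ) ≤ N)]
    have h4 := mul_le_mul h3 h2 (polyInt_mul_self_nonneg _) (by positivity)
    linarith
  have hfin : p - polyProj Φ (N + 1) p = e - polyProj Φ (N + 1) e := by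
    rw [he, polyProj_sub, hΦ.polyProj_eq_self hqdeg]; ring
  rw [hfin, Polynomial.eval_sub]
  -- `(α - β)² ≤ 2α² + 2β²` with the bounds `4E` and `6E` gives the constant `20`.
  nlinarith [sq_nonneg (e.eval x + (polyProj Φ (N + 1) e).eval x)]

end Projection


/-! ### Continuous functions with a square integrable weak derivative -/

lemma interior_Ixi : interior Ixi = Ioo (-√3) √3 := interior_Icc

/-- A smooth function of mean zero with compact support in the interior of `Ixi` is the derivative
of such a function. -/
lemma exists_primitive_test {χ : ℝ → ℝ} (hχ : ContDiff ℝ ((⊤ : ℕ∞) : WithTop ℕ∞) χ) {c d : ℝ}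
    (hc : -√3 < c) (hd : d < √3) (hsupp : ∀ x, x ∉ Icc c d → χ x = 0)
    (h0 : ∫ z, χ z ∂lebXi = 0) :
    ∃ φ : ℝ → ℝ, ContDiff ℝ ((⊤ : ℕ∞) : WithTop ℕ∞) φ ∧ HasCompactSupport φ ∧
      tsupport φ ⊆ interior Ixi ∧ deriv φ = χ := by
  have hcont := hχ.continuous
  set φ : ℝ → ℝ := fun x => ∫ z in (-√3)..x, χ z with hφ
  have hder : ∀ x, HasDerivAt φ (χ x) x := fun x => hcont.integral_hasStrictDerivAt _ _ |>.hasDerivAt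
  have hderiv : deriv φ = χ := funext fun x => (hder x).deriv
  have hzero : ∀ x, x ∉ Icc c d → φ x = 0 := by
    intro x hx
    rcases lt_or_ge x c with h | h
    · refine intervalIntegral.integral_zero_ae (Filter.Eventually.of_forall fun z hz => hsupp z ?_)
      rintro ⟨h1, -⟩
      have : z ≤ max (-√3) x := hz.2
      have : max (-√3) x < c := max_lt hc h
      linarith
    · have hx' : d < x := by by_contra hh; exact hx ⟨h, not_lt.1 hh⟩
      have hi : ∀ a b : ℝ, IntervalIntegrable χ volume a b := fun a b => hcont.intervalIntegrable a b
      have h2 : ∫ z in √3..x, χ z = 0 := by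
        refine intervalIntegral.integral_zero_ae (Filter.Eventually.of_forall fun z hz => hsupp z ?_)
        rintro ⟨-, h1⟩
        have : min √3 x < z := hz.1
        have : d < min √3 x := lt_min hd hx'
        linarith
      rw [integral_lebXi] at h0
      rw [hφ]
      simp only
      rw [← intervalIntegral.integral_add_adjacent_intervals (hi (-√3) √3) (hi √3 x), h0, h2, add_zero]
  have hts : tsupport φ ⊆ Icc c d :=
    closure_minimal (fun x hx => by by_contra h; exact hx (hzero x h)) isClosed_Icc
  refine ⟨φ, ?_, HasCompactSupport.of_support_subset_isCompact isCompact_Icc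
    (subset_closure.trans hts), ?_, hderiv⟩
  · refine contDiff_infty_iff_deriv.2 ⟨fun x => (hder x).differentiableAt, ?_⟩
    rw [hderiv]; exact hχ
  · rw [interior_Ixi]
    exact hts.trans fun x hx => ⟨hc.trans_le hx.1, hx.2.trans_lt hd⟩

/-- Integration by parts for absolutely continuous functions, since a primitive of an integrable
function need not be differentiable everywhere. The boundary terms vanish: `φ` is zero at `√3` and
the primitive is zero at `-√3`. -/
lemma integral_test_mul_primitive {φ g : ℝ → ℝ} (hφ : ContDiff ℝ ((⊤ : ℕ∞) : WithTop ℕ∞) φ)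
    (hsupp : tsupport φ ⊆ interior Ixi) (hg : Integrable g lebXi) :
    ∫ z, deriv φ z * (∫ y in (-√3)..z, g y) ∂lebXi = -∫ z, φ z * g z ∂lebXi := by
  have hgi : IntervalIntegrable g volume (-√3) √3 :=
    intervalIntegrable_of_lebXi hg ⟨neg_sqrt_three_le, le_rfl⟩
  have hG := hgi.absolutelyContinuousOnInterval_intervalIntegral (c := -√3) left_mem_uIcc
  have hF : AbsolutelyContinuousOnInterval φ (-√3) √3 :=
    (hφ.of_le (by exact_mod_cast le_top)).contDiffOn.absolutelyContinuousOnInterval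
  have h := hF.integral_mul_deriv_eq_deriv_mul hG
  have hb : φ √3 = 0 := image_eq_zero_of_notMem_tsupport fun hh => by
    have := hsupp hh
    rw [interior_Ixi] at this
    exact lt_irrefl _ this.2
  have hcongr : ∫ x in (-√3)..√3, φ x * deriv (fun x => ∫ v in (-√3)..x, g v) x =
      ∫ x in (-√3)..√3, φ x * g x := by
    refine intervalIntegral.integral_congr_ae ?_
    filter_upwards [hgi.ae_hasDerivAt_integral] with x hx hx2
    rw [(hx (uIoc_subset_uIcc hx2) (-√3) left_mem_uIcc).deriv]
  rw [hcongr, hb, intervalIntegral.integral_same] at h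
  rw [integral_lebXi, integral_lebXi]
  linarith

/-- The fundamental theorem of calculus for a continuous function with an integrable weak
derivative. -/
theorem HasWeakDeriv.eq_add_integral {u g : ℝ → ℝ} (hu : ContinuousOn u Ixi)
    (hg : Integrable g lebXi) (h : HasWeakDeriv 1 u g) {x : ℝ} (hx : x ∈ Ixi) :
    u x = u (-√3) + ∫ z in (-√3)..x, g z := by
  have hgi : IntervalIntegrable g volume (-√3) √3 :=
    intervalIntegrable_of_lebXi hg ⟨neg_sqrt_three_le, le_rfl⟩
  set G : ℝ → ℝ := fun x => ∫ z in (-√3)..x, g z with hG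
  have hGc : ContinuousOn G Ixi := by
    have := (hgi.absolutelyContinuousOnInterval_intervalIntegral (c := -√3)
      left_mem_uIcc).continuousOn
    rwa [uIcc_of_le neg_sqrt_three_le] at this
  -- It suffices that `v` is constant. It has weak derivative zero, so this is the du Bois-Reymond
  -- lemma.
  set v : ℝ → ℝ := fun z => u z - G z with hv
  have hvc : ContinuousOn v Ixi := hu.sub hGc
  let B : ContDiffBump (0 : ℝ) := ⟨1 / 2, 1, by norm_num, by norm_num⟩
  set θ : ℝ → ℝ := B.normed volume with hθ
  have hθt : tsupport θ = Icc (-1) 1 := by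
    rw [hθ, B.tsupport_normed_eq, Real.closedBall_eq_Icc]; simp [B]
  have hθd : ContDiff ℝ ((⊤ : ℕ∞) : WithTop ℕ∞) θ := B.contDiff_normed
  have h1lt : (1 : ℝ) < √3 := by nlinarith [sqrt_three_pos, sq_sqrt_three]
  have hmul : ∀ ψ : ℝ → ℝ, Continuous ψ → Integrable (fun z => ψ z * v z) lebXi := fun ψ hψ =>
    integrable_lebXi_of_continuousOn (hψ.continuousOn.mul hvc)
  have hfull : ∀ ψ : ℝ → ℝ, tsupport ψ ⊆ Ioo (-√3) √3 → ∫ z, ψ z ∂lebXi = ∫ z, ψ z := by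
    intro ψ hψ
    refine setIntegral_eq_integral_of_forall_compl_eq_zero fun z hz => ?_
    exact image_eq_zero_of_notMem_tsupport fun hh => hz (Ioo_subset_Icc_self (hψ hh))
  have hθI : ∫ z, θ z ∂lebXi = 1 := by
    rw [hfull θ, hθ, B.integral_normed]
    rw [hθt]
    exact Icc_subset_Ioo (by linarith) h1lt
  set c : ℝ := ∫ z, θ z * v z ∂lebXi with hcdef
  -- With `θ` a bump of integral one and `m = ∫ ψ`, the function `ψ - m θ` has mean zero, hence is
  -- the derivative of a test function, and `v` integrates to zero against it. Thus `∫ ψ v = m c = ∫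
  -- ψ c`.
  have key : ∀ ψ : ℝ → ℝ, ContDiff ℝ ((⊤ : ℕ∞) : WithTop ℕ∞) ψ → HasCompactSupport ψ →
      tsupport ψ ⊆ Ioo (-√3) √3 → ∫ z, ψ z • (v z - c) = 0 := by
    intro ψ hψd hψc hψs
    set m : ℝ := ∫ z, ψ z ∂lebXi with hm
    set K := tsupport ψ ∪ Icc (-1 : ℝ) 1 with hK
    have hKc : IsCompact K := hψc.isCompact.union isCompact_Icc
    have hKn : K.Nonempty := ⟨0, Or.inr (by simp)⟩
    have hKs : K ⊆ Ioo (-√3) √3 := union_subset hψs (Icc_subset_Ioo (by linarith) h1lt)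
    have hψi : Integrable ψ lebXi := integrable_lebXi_of_continuousOn hψd.continuous.continuousOn
    have hθi : Integrable θ lebXi := integrable_lebXi_of_continuousOn hθd.continuous.continuousOn
    obtain ⟨φ, hφd, hφc, hφs, hφ'⟩ := exists_primitive_test (χ := fun z => ψ z - m * θ z)
      (hψd.sub (contDiff_const.mul hθd)) (c := sInf K) (d := sSup K)
      (hKs (hKc.sInf_mem hKn)).1 (hKs (hKc.sSup_mem hKn)).2
      (by
        intro x hx
        have hxK : x ∉ K := fun hh =>
          hx ⟨csInf_le hKc.bddBelow hh, le_csSup hKc.bddAbove hh⟩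
        have e1 : ψ x = 0 := image_eq_zero_of_notMem_tsupport fun hh => hxK (Or.inl hh)
        have e2 : θ x = 0 := image_eq_zero_of_notMem_tsupport fun hh => hxK (Or.inr (hθt ▸ hh))
        simp [e1, e2])
      (by rw [integral_sub hψi (hθi.const_mul m), integral_const_mul, hθI, ← hm]; ring)
    have hw := h φ hφd hφc hφs
    have hp := integral_test_mul_primitive hφd hφs hg
    simp only [iteratedDeriv_one, smul_eq_mul, pow_one, neg_mul, one_mul, hφ'] at hw hp
    have hχc : Continuous fun z => ψ z - m * θ z :=
      hψd.continuous.sub (continuous_const.mul hθd.continuous)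
    have h0 : ∫ z, (ψ z - m * θ z) * v z ∂lebXi = 0 := by
      have e : ∀ z, (ψ z - m * θ z) * v z = (ψ z - m * θ z) * u z - (ψ z - m * θ z) * G z :=
        fun z => by rw [hv]; ring
      simp only [e]
      have i1 : Integrable (fun z => (ψ z - m * θ z) * u z) lebXi :=
        integrable_lebXi_of_continuousOn (hχc.continuousOn.mul hu)
      have i2 : Integrable (fun z => (ψ z - m * θ z) * G z) lebXi :=
        integrable_lebXi_of_continuousOn (hχc.continuousOn.mul hGc)
      rw [integral_sub i1 i2, hw, hp]
      ring
    have h1 : ∫ z, ψ z * v z ∂lebXi = m * c := by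
      have e : ∀ z, (ψ z - m * θ z) * v z = ψ z * v z - m * (θ z * v z) := fun z => by ring
      simp only [e] at h0
      rw [integral_sub (hmul ψ hψd.continuous) ((hmul θ hθd.continuous).const_mul m),
        integral_const_mul] at h0
      linarith
    rw [← hfull]
    · simp only [smul_eq_mul, mul_sub]
      rw [integral_sub (hmul ψ hψd.continuous) (hψi.mul_const c), integral_mul_const, h1, hm]
      ring
    · exact (tsupport_smul_subset_left ψ _).trans hψs
  have hae := isOpen_Ioo.ae_eq_zero_of_integral_contDiff_smul_eq_zero (μ := volume)
    (U := Ioo (-√3) √3) (f := fun z => v z - c)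
    (((hvc.sub continuousOn_const).mono Ioo_subset_Icc_self).locallyIntegrableOn measurableSet_Ioo)
    key
  have hEq : EqOn v (fun _ => c) (Icc (-√3) √3) := by
    refine Measure.eqOn_Icc_of_ae_eq volume (by linarith [sqrt_three_pos]) ?_ hvc continuousOn_const
    rw [← restrict_Ioo_eq_restrict_Icc]
    refine (ae_restrict_iff' measurableSet_Ioo).2 ?_
    filter_upwards [hae] with z hz hz2
    exact sub_eq_zero.1 (hz hz2)
  have e1 : v x = c := hEq hx
  have e2 : v (-√3) = c := hEq ⟨le_rfl, neg_sqrt_three_le⟩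
  simp only [hv, hG, intervalIntegral.integral_same] at e1 e2
  linarith

/-! ### Uniform convergence of the projections -/

/-- Density of continuous functions, then Weierstrass. Squaring the triangle inequality costs a
factor `2` on each part, giving `2 · ε/4` plus the length `2√3 ≤ 4` times `2 · ε/16`. -/
lemma exists_polynomial_integral_sq_le {g : ℝ → ℝ} (hg : MemLp g 2 lebXi) {ε : ℝ} (hε : 0 < ε) :
    ∃ r : ℝ[X], ∫ z, (g z - r.eval z) ^ 2 ∂lebXi ≤ ε := by
  have : lebXi.Regular := by unfold lebXi; infer_instance
  have hg' : MemLp g (ENNReal.ofReal 2) lebXi := by simpa using hg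
  obtain ⟨w, -, hw1, hwc, -⟩ := hg'.exists_hasCompactSupport_integral_rpow_sub_le
    (p := 2) (by norm_num) (ε := ε / 4) (by positivity)
  simp only [Real.rpow_ofNat, Real.norm_eq_abs, sq_abs] at hw1
  obtain ⟨r, hr⟩ := exists_polynomial_near_of_continuousOn (-√3) √3 w hwc.continuousOn
    (√(ε / 16)) (Real.sqrt_pos.2 (by positivity))
  refine ⟨r, ?_⟩
  have hw2 : MemLp w 2 lebXi := memLp_of_continuousOn hwc.continuousOn 2
  have hr2 : MemLp (fun z => r.eval z) 2 lebXi := memLp_of_continuousOn r.continuous.continuousOn 2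
  have i1 : Integrable (fun z => 2 * (g z - w z) ^ 2) lebXi := (hg.sub hw2).integrable_sq.const_mul 2
  calc ∫ z, (g z - r.eval z) ^ 2 ∂lebXi ≤ ∫ z, (2 * (g z - w z) ^ 2 + ε / 8) ∂lebXi := by
        refine integral_mono_ae (hg.sub hr2).integrable_sq (i1.add (integrable_const _)) ?_
        filter_upwards [ae_mem_Ixi] with z hz
        have h1 := hr z hz
        have h2 : (r.eval z - w z) ^ 2 ≤ ε / 16 := by
          rw [← sq_abs, ← Real.sq_sqrt (show 0 ≤ ε / 16 by positivity)]
          gcongr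
        nlinarith [sq_nonneg ((g z - w z) + (r.eval z - w z))]
    _ = 2 * ∫ z, (g z - w z) ^ 2 ∂lebXi + (√3 - -√3) * (ε / 8) := by
        rw [integral_add i1 (integrable_const _), integral_const_mul]
        congr 1
        rw [integral_lebXi, intervalIntegral.integral_const, smul_eq_mul]
    _ ≤ ε := by nlinarith [sqrt_three_le]

lemma exists_polynomial_primitive (r : ℝ[X]) (y : ℝ) :
    ∃ R : ℝ[X], Polynomial.derivative R = r ∧ R.eval (-√3) = y := by
  obtain ⟨q, hq⟩ := exists_derivative_eq r
  refine ⟨q + Polynomial.C (y - q.eval (-√3)), ?_, ?_⟩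
  · rw [map_add, Polynomial.derivative_C, add_zero, hq]
  · simp

lemma sq_sub_primitive_le {u g : ℝ → ℝ} (hg : MemLp g 2 lebXi)
    (hug : ∀ x ∈ Ixi, u x = u (-√3) + ∫ z in (-√3)..x, g z) {R : ℝ[X]}
    (hR : R.eval (-√3) = u (-√3)) {x : ℝ} (hx : x ∈ Ixi) :
    (u x - R.eval x) ^ 2 ≤ 4 * ∫ z, (g z - (Polynomial.derivative R).eval z) ^ 2 ∂lebXi := by
  have hr2 : MemLp (fun z => (Polynomial.derivative R).eval z) 2 lebXi :=
    memLp_of_continuousOn (Polynomial.derivative R).continuous.continuousOn 2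
  have h := sq_intervalIntegral_le (hg.sub hr2) hx
  have e : ∫ z in (-√3)..x, (g - fun z => (Polynomial.derivative R).eval z) z =
      u x - R.eval x := by
    simp only [Pi.sub_apply]
    rw [intervalIntegral.integral_sub (intervalIntegrable_of_lebXi (hg.integrable (by norm_num)) hx)
      ((Polynomial.derivative R).continuous.intervalIntegrable _ _),
      intervalIntegral.integral_eq_sub_of_hasDerivAt (fun y _ => R.hasDerivAt y)
      ((Polynomial.derivative R).continuous.intervalIntegrable _ _), hug x hx, hR]
    ring
  rw [e] at h
  exact h

variable {Φ : ℕ → ℝ[X]}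

/-- For fixed `N` the projection is a finite sum of integrals, so dominated convergence suffices. It
carries the estimate for polynomials over to their limits, with constants independent of `N`. -/
lemma tendsto_eval_scalarProj (N : ℕ) {u : ℝ → ℝ} (hu : ContinuousOn u Ixi) {v : ℕ → ℝ → ℝ}
    (hv : ∀ m, ContinuousOn (v m) Ixi) {C : ℝ} (hC : ∀ m, ∀ z ∈ Ixi, |v m z - u z| ≤ C)
    (hlim : ∀ z ∈ Ixi, Tendsto (fun m => v m z) atTop (𝓝 (u z))) (x : ℝ) :
    Tendsto (fun m => (scalarProj Φ N (v m)).eval x) atTop (𝓝 ((scalarProj Φ N u).eval x)) := by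
  simp only [scalarProj, Polynomial.eval_finsetSum, Polynomial.eval_mul, Polynomial.eval_C]
  refine tendsto_finsetSum _ fun k _ => Tendsto.mul_const _ (Tendsto.const_mul _ ?_)
  refine tendsto_integral_of_dominated_convergence (fun z => |(Φ k).eval z| * (|u z| + C)) ?_ ?_ ?_ ?_
  · exact fun m => (integrable_lebXi_of_continuousOn
      ((Φ k).continuous.continuousOn.mul (hv m))).aestronglyMeasurable
  · exact integrable_lebXi_of_continuousOn
      ((Φ k).continuous.abs.continuousOn.mul (hu.abs.add continuousOn_const))
  · intro m
    filter_upwards [ae_mem_Ixi] with z hz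
    rw [norm_mul, Real.norm_eq_abs, Real.norm_eq_abs]
    refine mul_le_mul_of_nonneg_left ?_ (abs_nonneg _)
    have := abs_add_le (u z) (v m z - u z)
    rw [add_sub_cancel] at this
    linarith [hC m z hz]
  · filter_upwards [ae_mem_Ixi] with z hz
    exact (hlim z hz).const_mul _

/-- Approximate `u` by polynomials `P m` whose derivatives tend to `g` in `L²`, and apply the
polynomial estimate to `P m - R`, which has the same projection error as `P m`. The constant is `20
· 2`, from comparing `P m' - R'` with `g - R'`. -/
lemma IsOrthogonalFamily.sq_sub_scalarProj_le (hΦ : IsOrthogonalFamily Φ) {u g : ℝ → ℝ}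
    (hu : ContinuousOn u Ixi) (hg : MemLp g 2 lebXi)
    (hug : ∀ x ∈ Ixi, u x = u (-√3) + ∫ z in (-√3)..x, g z) {R : ℝ[X]} {N : ℕ}
    (hRdeg : R.degree < (N + 1 + 1 : ℕ)) {x : ℝ} (hx : x ∈ Ixi) :
    (u x - (scalarProj Φ (N + 1) u).eval x) ^ 2 ≤
      40 * ∫ z, (g z - (Polynomial.derivative R).eval z) ^ 2 ∂lebXi := by
  choose r hr using fun m : ℕ => exists_polynomial_integral_sq_le hg (ε := 1 / ((m : ℝ) + 1))
    (by positivity)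
  choose P hP hP0 using fun m : ℕ => exists_polynomial_primitive (r m) (u (-√3))
  have hdist : ∀ m, ∀ z ∈ Ixi, (u z - (P m).eval z) ^ 2 ≤ 4 * (1 / ((m : ℝ) + 1)) := by
    intro m z hz
    have h := sq_sub_primitive_le hg hug (hP0 m) hz
    rw [hP m] at h
    linarith [hr m]
  have hto : Tendsto (fun m : ℕ => 1 / ((m : ℝ) + 1)) atTop (𝓝 0) :=
    tendsto_one_div_add_atTop_nhds_zero_nat
  have hlim : ∀ z ∈ Ixi, Tendsto (fun m => (P m).eval z) atTop (𝓝 (u z)) := by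
    intro z hz
    have h1 : Tendsto (fun m => (u z - (P m).eval z) ^ 2) atTop (𝓝 0) :=
      squeeze_zero (fun m => sq_nonneg _) (fun m => hdist m z hz)
        (by simpa using hto.const_mul 4)
    have h2 := h1.sqrt
    simp only [Real.sqrt_sq_eq_abs, Real.sqrt_zero] at h2
    have h3 := (tendsto_zero_iff_abs_tendsto_zero _).2 h2
    simpa using h3.const_sub (u z)
  have hbd : ∀ m, ∀ z ∈ Ixi, |(P m).eval z - u z| ≤ 2 := by
    intro m z hz
    have h1 : 1 / ((m : ℝ) + 1) ≤ 1 := (div_le_one (by positivity)).2 (by linarith [m.cast_nonneg (α := ℝ)])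
    refine abs_le_of_sq_le_sq ?_ (by norm_num)
    have := hdist m z hz
    nlinarith
  have hconv := ((hlim x hx).sub (tendsto_eval_scalarProj (Φ := Φ) (N + 1) hu
    (fun m => (P m).continuous.continuousOn) hbd hlim x)).pow 2
  have hRHS : Tendsto (fun m : ℕ => 40 * (1 / ((m : ℝ) + 1)) +
      40 * ∫ z, (g z - (Polynomial.derivative R).eval z) ^ 2 ∂lebXi) atTop
      (𝓝 (40 * ∫ z, (g z - (Polynomial.derivative R).eval z) ^ 2 ∂lebXi)) := by
    simpa using (hto.const_mul 40).add_const _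
  refine le_of_tendsto_of_tendsto' hconv hRHS fun m => ?_
  have hsub : (P m).eval x - (scalarProj Φ (N + 1) fun z => (P m).eval z).eval x =
      ((P m - R) - polyProj Φ (N + 1) (P m - R)).eval x := by
    rw [polyProj_sub, hΦ.polyProj_eq_self hRdeg]
    simp
  rw [hsub]
  refine (hΦ.eval_sub_polyProj_sq_le N (P m - R) hx).trans ?_
  have hm2 : ∀ p : ℝ[X], MemLp (fun z => p.eval z) 2 lebXi := fun p =>
    memLp_of_continuousOn p.continuous.continuousOn 2
  have i1 : Integrable (fun z => (g z - (r m).eval z) ^ 2) lebXi := (hg.sub (hm2 _)).integrable_sq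
  have i2 : Integrable (fun z => (g z - (Polynomial.derivative R).eval z) ^ 2) lebXi :=
    (hg.sub (hm2 _)).integrable_sq
  have hI : polyInt (Polynomial.derivative (P m - R) * Polynomial.derivative (P m - R)) ≤
      2 * (∫ z, (g z - (r m).eval z) ^ 2 ∂lebXi) +
        2 * ∫ z, (g z - (Polynomial.derivative R).eval z) ^ 2 ∂lebXi := by
    rw [polyInt_apply, ← integral_const_mul, ← integral_const_mul,
      ← integral_add (i1.const_mul 2) (i2.const_mul 2)]
    refine integral_mono (integrable_polynomial _) ((i1.const_mul 2).add (i2.const_mul 2)) fun z => ?_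
    simp only [map_sub, hP m, Polynomial.eval_mul, Polynomial.eval_sub]
    nlinarith [sq_nonneg ((g z - (r m).eval z) + (g z - (Polynomial.derivative R).eval z))]
  linarith [hr m]

/-- For a continuous function with a square integrable weak derivative, the orthogonal projections
onto polynomials converge uniformly. -/
theorem IsOrthogonalFamily.eventually_abs_sub_scalarProj_le (hΦ : IsOrthogonalFamily Φ)
    {u g : ℝ → ℝ} (hu : ContinuousOn u Ixi) (hg : MemLp g 2 lebXi) (h : HasWeakDeriv 1 u g)
    {ε : ℝ} (hε : 0 < ε) :
    ∀ᶠ N in atTop, ∀ x ∈ Ixi, |u x - (scalarProj Φ N u).eval x| ≤ ε := by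
  obtain ⟨r, hr⟩ := exists_polynomial_integral_sq_le hg (ε := ε ^ 2 / 40) (by positivity)
  -- The initial value `0` is arbitrary: only `R'` enters the bound. Once `N` exceeds the degree of
  -- `R`, the error is controlled by the fixed distance of `R'` from `g`.
  obtain ⟨R, hR, -⟩ := exists_polynomial_primitive r 0
  filter_upwards [eventually_ge_atTop (R.natDegree + 1)] with N hN x hx
  obtain ⟨N, rfl⟩ : ∃ j, N = j + 1 := ⟨N - 1, by omega⟩
  have hdeg : R.degree < (N + 1 + 1 : ℕ) :=
    Polynomial.degree_le_natDegree.trans_lt (by exact_mod_cast (by omega))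
  have h1 := hΦ.sq_sub_scalarProj_le hu hg
    (fun x hx => h.eq_add_integral hu (hg.integrable (by norm_num)) hx) hdeg hx
  rw [hR] at h1
  exact abs_le_of_sq_le_sq (by linarith) hε.le


/-! ### The parameter -/

lemma integral_uniformLaw {a b : ℝ} (hab : a < b) (v : ℝ → ℝ) :
    ∫ x, v x ∂(uniformLaw a b) = (b - a)⁻¹ * ∫ x in a..b, v x := by
  rw [uniformLaw, ProbabilityTheory.cond, integral_smul_measure,
    intervalIntegral.integral_of_le hab.le, integral_Icc_eq_integral_Ioc, Real.volume_Icc,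
    ENNReal.toReal_inv, ENNReal.toReal_ofReal (by linarith), smul_eq_mul]

lemma paramMean_eq {a b : ℝ} (hab : a < b) : paramMean a b = (a + b) / 2 := by
  rw [paramMean, integral_uniformLaw hab, integral_id]
  have : b - a ≠ 0 := by linarith
  field_simp
  ring

lemma paramStd_eq {a b : ℝ} (hab : a < b) : paramStd a b = (b - a) / 2 / √3 := by
  have h : ∫ x, (x - paramMean a b) ^ 2 ∂(uniformLaw a b) = (b - a) ^ 2 / 12 := by
    rw [integral_uniformLaw hab, paramMean_eq hab,
      intervalIntegral.integral_comp_sub_right (fun x => x ^ 2), integral_pow]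
    have : b - a ≠ 0 := by linarith
    field_simp
    push_cast
    ring
  rw [paramStd, h]
  rw [Real.sqrt_eq_iff_mul_self_eq (by positivity) (div_nonneg (by linarith) (Real.sqrt_nonneg 3)), div_mul_div_comm, sq_sqrt_three]
  ring

/-- `√3` standard deviations are exactly half the length of the parameter interval. -/
lemma param_mem {a b : ℝ} (hab : a < b) {z : ℝ} (hz : z ∈ Ixi) : param a b z ∈ Icc a b := by
  rw [param, paramMean_eq hab, paramStd_eq hab]
  have h3 := sqrt_three_pos
  have hl : -1 ≤ z / √3 := by rw [le_div_iff₀ h3]; linarith [hz.1]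
  have hr : z / √3 ≤ 1 := by rw [div_le_iff₀ h3]; linarith [hz.2]
  have e : (b - a) / 2 / √3 * z = (b - a) / 2 * (z / √3) := by ring
  rw [e]
  constructor <;> nlinarith

lemma continuous_param (a b : ℝ) : Continuous (param a b) := by
  unfold param; fun_prop

/-! ### Synthesis and projection of vector-valued curves -/

section Vector

variable {n : ℕ} {Φ : ℕ → ℝ[X]} {N : ℕ}

lemma continuous_synth (c : Coeff n N) : Continuous (synth Φ c) := by
  unfold synth
  exact continuous_finsetSum _ fun j _ => (Φ j).continuous.smul continuous_const

lemma synth_sub (c d : Coeff n N) (z : ℝ) : synth Φ (c - d) z = synth Φ c z - synth Φ d z := by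
  simp [synth, smul_sub]

lemma integrable_eval_smul {v : ℝ → EuclideanSpace ℝ (Fin n)} (hv : MemLp v 2 lebXi) (p : ℝ[X]) :
    Integrable (fun z => p.eval z • v z) lebXi :=
  memLp_one_iff_integrable.1 (hv.smul (memLp_of_continuousOn p.continuous.continuousOn 2))

lemma integrable_inner_of_memLp {v w : ℝ → EuclideanSpace ℝ (Fin n)} (hv : MemLp v 2 lebXi)
    (hw : MemLp w 2 lebXi) : Integrable (fun z => (inner ℝ (v z) (w z) : ℝ)) lebXi :=
  (hv.norm.integrable_mul hw.norm).mono' (hv.1.inner hw.1)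
    (Eventually.of_forall fun z => norm_inner_le_norm (v z) (w z))

/-- Testing the projection against coefficients is testing the function against their synthesis. -/
lemma IsOrthogonalFamily.sum_inner_projCoeff (hΦ : IsOrthogonalFamily Φ)
    {v : ℝ → EuclideanSpace ℝ (Fin n)} (hv : MemLp v 2 lebXi) (h : Coeff n N) :
    ∑ i : Fin (N + 1), sqNorm Φ i * inner ℝ (projCoeff Φ N v i) (h i) =
      ∫ z, inner ℝ (v z) (synth Φ h z) ∂lebXi := by
  have e : ∀ z, (inner ℝ (v z) (synth Φ h z) : ℝ) =
      ∑ i : Fin (N + 1), inner ℝ (h i) ((Φ i).eval z • v z) := by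
    intro z
    rw [synth, inner_sum]
    refine Finset.sum_congr rfl fun i _ => ?_
    rw [inner_smul_right, inner_smul_right, real_inner_comm]
  simp only [e]
  rw [integral_finsetSum _ fun (i : Fin (N + 1)) _ =>
    (integrable_eval_smul hv (Φ i)).const_inner (h i)]
  refine Finset.sum_congr rfl fun i _ => ?_
  rw [integral_inner (integrable_eval_smul hv (Φ i)), projCoeff, real_inner_smul_left, ← mul_assoc,
    mul_inv_cancel₀ (hΦ.sqNorm_pos i).ne', one_mul, real_inner_comm]

lemma IsOrthogonalFamily.projCoeff_synth (hΦ : IsOrthogonalFamily Φ) (c : Coeff n N) :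
    projCoeff Φ N (synth Φ c) = c := by
  funext i
  have e : ∀ z, (Φ i).eval z • synth Φ c z =
      ∑ j : Fin (N + 1), ((Φ i).eval z * (Φ j).eval z) • c j := by
    intro z
    rw [synth, Finset.smul_sum]
    simp only [smul_smul]
  have hint : ∀ j : Fin (N + 1), Integrable (fun z => (Φ i).eval z * (Φ j).eval z) lebXi := fun j =>
    integrable_lebXi_of_continuousOn ((Φ i).continuous.mul (Φ j).continuous).continuousOn
  rw [projCoeff]
  simp only [e]
  rw [integral_finsetSum _ fun j _ => (hint j).smul_const (c j), Finset.sum_eq_single i]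
  · rw [integral_smul_const, smul_smul]
    simp only [← sq]
    rw [← sqNorm, inv_mul_cancel₀ (hΦ.sqNorm_pos i).ne', one_smul]
  · intro j _ hj
    rw [integral_smul_const, hΦ.2 i j fun h => hj (Fin.ext h).symm, zero_smul]
  · simp

lemma starNorm_nonneg (c : Coeff n N) : 0 ≤ starNorm Φ c := Real.sqrt_nonneg _

lemma IsOrthogonalFamily.starNorm_sq (hΦ : IsOrthogonalFamily Φ) (c : Coeff n N) :
    starNorm Φ c ^ 2 = ∑ i : Fin (N + 1), sqNorm Φ i * inner ℝ (c i) (c i) := by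
  rw [starNorm, Real.sq_sqrt (Finset.sum_nonneg fun (i : Fin (N + 1)) _ =>
    mul_nonneg (sq_nonneg _) (hΦ.sqNorm_pos i).le)]
  exact Finset.sum_congr rfl fun i _ => by rw [real_inner_self_eq_norm_sq, mul_comm]

lemma memLp_synth (c : Coeff n N) : MemLp (synth Φ c) 2 lebXi :=
  memLp_of_continuousOn (continuous_synth c).continuousOn 2

/-- Parseval's identity. -/
lemma IsOrthogonalFamily.starNorm_sq_eq_integral (hΦ : IsOrthogonalFamily Φ) (c : Coeff n N) :
    starNorm Φ c ^ 2 = ∫ z, ‖synth Φ c z‖ ^ 2 ∂lebXi := by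
  have h := hΦ.sum_inner_projCoeff (memLp_synth (Φ := Φ) c) c
  rw [hΦ.projCoeff_synth, ← hΦ.starNorm_sq] at h
  simpa only [real_inner_self_eq_norm_sq] using h

lemma IsOrthogonalFamily.sum_inner_le (hΦ : IsOrthogonalFamily Φ) (c d : Coeff n N) :
    ∑ i : Fin (N + 1), sqNorm Φ i * inner ℝ (c i) (d i) ≤ starNorm Φ c * starNorm Φ d := by
  have h := Real.sum_mul_le_sqrt_mul_sqrt Finset.univ
    (fun i : Fin (N + 1) => ‖c i‖ * √(sqNorm Φ i)) (fun i => ‖d i‖ * √(sqNorm Φ i))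
  simp only [mul_pow, Real.sq_sqrt (hΦ.sqNorm_pos _).le] at h
  refine le_trans (Finset.sum_le_sum fun i _ => ?_) h
  have h1 := mul_le_mul_of_nonneg_left (real_inner_le_norm (c i) (d i)) (hΦ.sqNorm_pos i).le
  have h2 := Real.mul_self_sqrt (hΦ.sqNorm_pos i).le
  calc sqNorm Φ i * inner ℝ (c i) (d i) ≤ sqNorm Φ i * (‖c i‖ * ‖d i‖) := h1
    _ = (√(sqNorm Φ i) * √(sqNorm Φ i)) * (‖c i‖ * ‖d i‖) := by rw [h2]
    _ = _ := by ring

/-- Bessel's inequality. -/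
lemma IsOrthogonalFamily.starNorm_projCoeff_sq_le (hΦ : IsOrthogonalFamily Φ)
    {v : ℝ → EuclideanSpace ℝ (Fin n)} (hv : MemLp v 2 lebXi) :
    starNorm Φ (projCoeff Φ N v) ^ 2 ≤ ∫ z, ‖v z‖ ^ 2 ∂lebXi := by
  set c : Coeff n N := projCoeff Φ N v with hc
  have h1 : starNorm Φ c ^ 2 = ∫ z, inner ℝ (v z) (synth Φ c z) ∂lebXi := by
    rw [hΦ.starNorm_sq, ← hΦ.sum_inner_projCoeff hv c]
  have h2 := hΦ.starNorm_sq_eq_integral c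
  have i1 : Integrable (fun z => ‖v z‖ ^ 2) lebXi := hv.integrable_norm_pow (by norm_num)
  have i2 : Integrable (fun z => ‖synth Φ c z‖ ^ 2) lebXi :=
    (memLp_synth c).integrable_norm_pow (by norm_num)
  have i3 : Integrable (fun z => (inner ℝ (v z) (synth Φ c z) : ℝ)) lebXi :=
    integrable_inner_of_memLp hv (memLp_synth c)
  -- The squared distance of `v` to its projection, expanded; by `h1` the cross term equals the
  -- squared norm of the projection.
  have h3 : 0 ≤ ∫ z, (‖v z‖ ^ 2 - 2 * inner ℝ (v z) (synth Φ c z) + ‖synth Φ c z‖ ^ 2) ∂lebXi := by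
    refine integral_nonneg fun z => ?_
    simp only [Pi.zero_apply]
    rw [← norm_sub_sq_real]
    positivity
  have i4 : Integrable (fun z => ‖v z‖ ^ 2 - 2 * inner ℝ (v z) (synth Φ c z)) lebXi :=
    i1.sub (i3.const_mul 2)
  rw [integral_add i4 i2, integral_sub i1 (i3.const_mul 2), integral_const_mul, ← h1, ← h2] at h3
  linarith

/-- Nikolskii's inequality for vector coefficients, by Cauchy–Schwarz with weights `√(sqNorm Φ i)`.
This is the source of the linear growth of `K`. -/
lemma IsOrthogonalFamily.norm_synth_le (hΦ : IsOrthogonalFamily Φ) (c : Coeff n N) {z : ℝ}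
    (hz : z ∈ Ixi) : ‖synth Φ c z‖ ≤ ((N : ℝ) + 1) * starNorm Φ c := by
  have h := Real.sum_mul_le_sqrt_mul_sqrt Finset.univ
    (fun i : Fin (N + 1) => |(Φ i).eval z| / √(sqNorm Φ i)) (fun i => ‖c i‖ * √(sqNorm Φ i))
  simp only [mul_pow, div_pow, sq_abs, Real.sq_sqrt (hΦ.sqNorm_pos _).le] at h
  have h1 : ‖synth Φ c z‖ ≤
      ∑ i : Fin (N + 1), |(Φ i).eval z| / √(sqNorm Φ i) * (‖c i‖ * √(sqNorm Φ i)) := by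
    refine (norm_sum_le _ _).trans (Finset.sum_le_sum fun i _ => ?_)
    rw [norm_smul, Real.norm_eq_abs]
    have := (Real.sqrt_pos.2 (hΦ.sqNorm_pos i)).ne'
    apply le_of_eq
    field_simp
  have h2 : √(∑ i : Fin (N + 1), (Φ i).eval z ^ 2 / sqNorm Φ i) ≤ (N : ℝ) + 1 := by
    rw [Real.sqrt_le_left (by positivity),
      ← Finset.sum_range fun i => (Φ i).eval z ^ 2 / sqNorm Φ i]
    exact hΦ.sum_eval_sq_div_le N hz
  exact h1.trans (h.trans (mul_le_mul_of_nonneg_right h2 (Real.sqrt_nonneg _)))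

lemma IsOrthogonalFamily.eq_zero_of_starNorm (hΦ : IsOrthogonalFamily Φ) {c : Coeff n N}
    (h : starNorm Φ c = 0) : c = 0 := by
  have h1 := hΦ.starNorm_sq c
  rw [h, zero_pow two_ne_zero, eq_comm, Finset.sum_eq_zero_iff_of_nonneg fun (i : Fin (N + 1)) _ =>
    mul_nonneg (hΦ.sqNorm_pos i).le real_inner_self_nonneg] at h1
  funext i
  exact inner_self_eq_zero.1 ((mul_eq_zero.1 (h1 i (Finset.mem_univ i))).resolve_left
    (hΦ.sqNorm_pos i).ne')

/-! ### Uniform convergence for vector-valued curves -/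

lemma HasWeakDeriv.component {u g : ℝ → EuclideanSpace ℝ (Fin n)} (hu : MemLp u 2 lebXi)
    (hg : MemLp g 2 lebXi) {k : ℕ} (h : HasWeakDeriv k u g) (l : Fin n) :
    HasWeakDeriv k (fun z => u z l) fun z => g z l := by
  intro φ hφ hc hs
  have hmem : ∀ ψ : ℝ → ℝ, Continuous ψ → ∀ v : ℝ → EuclideanSpace ℝ (Fin n), MemLp v 2 lebXi →
      ∫ z, ψ z • v z l ∂lebXi = (∫ z, ψ z • v z ∂lebXi) l := by
    intro ψ hψ v hv
    have hi : Integrable (fun z => ψ z • v z) lebXi :=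
      memLp_one_iff_integrable.1 (hv.smul (memLp_of_continuousOn hψ.continuousOn 2))
    exact (EuclideanSpace.proj (𝕜 := ℝ) l).integral_comp_comm hi
  rw [hmem φ hφ.continuous g hg,
    hmem _ (hφ.continuous_iteratedDeriv k (by exact_mod_cast le_top)) u hu, h φ hφ hc hs]
  simp

lemma synth_projCoeff_apply {u : ℝ → EuclideanSpace ℝ (Fin n)} (hu : MemLp u 2 lebXi) (z : ℝ)
    (l : Fin n) : synth Φ (projCoeff Φ N u) z l = (scalarProj Φ N fun y => u y l).eval z := by
  have h : ∀ i : Fin (N + 1), (∫ y, (Φ i).eval y • u y ∂lebXi) l =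
      ∫ y, (Φ i).eval y * u y l ∂lebXi := fun i =>
    ((EuclideanSpace.proj (𝕜 := ℝ) l).integral_comp_comm (integrable_eval_smul hu (Φ i))).symm
  rw [scalarProj, Polynomial.eval_finsetSum, Finset.sum_range]
  simp only [synth, projCoeff, WithLp.ofLp_sum, WithLp.ofLp_smul, Finset.sum_apply, Pi.smul_apply,
    smul_eq_mul, Polynomial.eval_mul, Polynomial.eval_C, h]
  exact Finset.sum_congr rfl fun i _ => mul_comm _ _

theorem IsOrthogonalFamily.eventually_norm_sub_synth_le (hΦ : IsOrthogonalFamily Φ)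
    {u : ℝ → EuclideanSpace ℝ (Fin n)} (hu : ContinuousOn u Ixi) {s : ℝ} (hs : 1 ≤ s)
    (hus : MemHs s u) {ε : ℝ} (hε : 0 < ε) :
    ∀ᶠ N in atTop, ∀ z ∈ Ixi, ‖u z - synth Φ (projCoeff Φ N u) z‖ ≤ ε := by
  obtain ⟨g, hg, hw, -⟩ := hus.2 1 (Nat.le_floor (by simpa using hs))
  -- Each of the `n` squared components contributes `ε² / (n + 1)²`, and `n ≤ (n + 1)²`; the shift
  -- also covers `n = 0`.
  have h : ∀ l : Fin n, ∀ᶠ N in atTop, ∀ z ∈ Ixi,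
      |u z l - (scalarProj Φ N fun y => u y l).eval z| ≤ ε / (n + 1) := fun l =>
    hΦ.eventually_abs_sub_scalarProj_le
      ((EuclideanSpace.proj (𝕜 := ℝ) l).continuous.comp_continuousOn hu)
      ((EuclideanSpace.proj (𝕜 := ℝ) l).comp_memLp' hg) (hw.component hus.1 hg l) (by positivity)
  filter_upwards [eventually_all.2 h] with N hN z hz
  refine abs_le_of_sq_le_sq' ?_ hε.le |>.2
  rw [EuclideanSpace.norm_sq_eq]
  have hl : ∀ l : Fin n, ‖(u z - synth Φ (projCoeff Φ N u) z) l‖ ^ 2 ≤ (ε / (n + 1)) ^ 2 := by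
    intro l
    rw [PiLp.sub_apply, synth_projCoeff_apply hus.1, Real.norm_eq_abs]
    exact pow_le_pow_left₀ (abs_nonneg _) (hN l z hz) 2
  refine (Finset.sum_le_sum fun l _ => hl l).trans ?_
  rw [Finset.sum_const, Finset.card_univ, Fintype.card_fin, nsmul_eq_mul, div_pow, mul_div_assoc',
    div_le_iff₀ (by positivity)]
  have : (n : ℝ) ≤ ((n : ℝ) + 1) ^ 2 := by nlinarith [n.cast_nonneg (α := ℝ)]
  nlinarith [sq_nonneg ε]

end Vector


/-! ### The Jacobian of the Galerkin operator -/

section Jacobian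

variable {n : ℕ} {a b : ℝ} {f : EuclideanSpace ℝ (Fin n) → ℝ → EuclideanSpace ℝ (Fin n)}
  {Φ : ℕ → ℝ[X]} {N : ℕ}

/-- Clamping the parameter to `[a, b]` extends `f` to a jointly continuous map for all real `z`, as
the measurability theorem for parametric derivatives requires. -/
lemma continuous_nemytskii_projIcc (hab : a < b)
    (hf : ContinuousOn (Function.uncurry f) (univ ×ˢ Icc a b)) :
    Continuous (Function.uncurry fun (z : ℝ) (v : EuclideanSpace ℝ (Fin n)) =>
      f v (projIcc a b hab.le (param a b z))) :=
  hf.comp_continuous (f := fun q : ℝ × EuclideanSpace ℝ (Fin n) =>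
      (q.2, (projIcc a b hab.le (param a b q.1) : ℝ)))
    (continuous_snd.prodMk (continuous_subtype_val.comp (continuous_projIcc.comp
      ((continuous_param a b).comp continuous_fst)))) fun _ => ⟨mem_univ _, Subtype.coe_prop _⟩

lemma continuousOn_nemytskii (hab : a < b)
    (hf : ContinuousOn (Function.uncurry f) (univ ×ˢ Icc a b))
    {w : ℝ → EuclideanSpace ℝ (Fin n)} (hw : Continuous w) :
    ContinuousOn (nemytskii f a b w) Ixi :=
  hf.comp (f := fun z => (w z, param a b z)) (hw.prodMk (continuous_param a b)).continuousOn
    fun _ hz => ⟨mem_univ _, param_mem hab hz⟩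

lemma aestronglyMeasurable_stateDeriv (hab : a < b)
    (hf : ContinuousOn (Function.uncurry f) (univ ×ˢ Icc a b))
    {w : ℝ → EuclideanSpace ℝ (Fin n)} (hw : Continuous w) :
    AEStronglyMeasurable (fun z => stateDeriv f (w z) (param a b z)) lebXi := by
  have h := (measurable_fderiv_with_param ℝ (continuous_nemytskii_projIcc hab hf)).comp
    (measurable_id.prodMk hw.measurable)
  refine h.stronglyMeasurable.aestronglyMeasurable.congr ?_
  filter_upwards [ae_mem_Ixi] with z hz
  simp only [Function.comp_apply, id_eq, stateDeriv]
  rw [projIcc_of_mem hab.le (param_mem hab hz)]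

lemma LocLipUnif.exists_norm_stateDeriv_le (hf : LocLipUnif f (Icc a b)) {R : ℝ} (hR : 0 < R) :
    ∃ B : ℝ, 0 ≤ B ∧ ∀ v, ‖v‖ ≤ R → ∀ m ∈ Icc a b, ‖stateDeriv f v m‖ ≤ B := by
  -- The larger radius `R + 1` contains a neighbourhood of every `v` in the ball, so the Lipschitz
  -- constant there bounds the derivative at `v`.
  obtain ⟨L, hL, h⟩ := hf (R + 1) (by linarith)
  refine ⟨L, hL.le, fun v hv m hm => norm_fderiv_le_of_lip' ℝ hL.le ?_⟩
  filter_upwards [Metric.ball_mem_nhds v one_pos] with x hx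
  refine h x v ?_ (by linarith) m hm
  have h1 : ‖x - v‖ < 1 := by rwa [← dist_eq_norm]
  have h2 := norm_add_le (x - v) v
  rw [sub_add_cancel] at h2
  linarith

/-- Synthesis, evaluated at a point, as a continuous linear map of the coefficients. -/
noncomputable def synthCLM (n : ℕ) (Φ : ℕ → ℝ[X]) (N : ℕ) (z : ℝ) :
    Coeff n N →L[ℝ] EuclideanSpace ℝ (Fin n) :=
  ∑ j : Fin (N + 1), (Φ j).eval z • ContinuousLinearMap.proj j

lemma synthCLM_apply (c : Coeff n N) (z : ℝ) : synthCLM n Φ N z c = synth Φ c z := by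
  simp [synthCLM, synth]

lemma continuous_synthCLM : Continuous (synthCLM n Φ N) := by
  unfold synthCLM
  exact continuous_finsetSum _ fun j _ => (Φ j).continuous.smul continuous_const

/-- The derivative of the Nemytskii operator at `synth Φ c`, applied to `synth Φ h`. -/
noncomputable def linearized (f : EuclideanSpace ℝ (Fin n) → ℝ → EuclideanSpace ℝ (Fin n)) (a b : ℝ)
    (Φ : ℕ → ℝ[X]) (c h : Coeff n N) (z : ℝ) : EuclideanSpace ℝ (Fin n) :=
  stateDeriv f (synth Φ c z) (param a b z) (synth Φ h z)

lemma exists_norm_synth_le (R : ℝ) :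
    ∃ M : ℝ, 0 < M ∧ ∀ c : Coeff n N, ‖c‖ ≤ R → ∀ z ∈ Ixi, ‖synth Φ c z‖ ≤ M := by
  obtain ⟨S, hS⟩ := (isCompact_Icc (a := -√3) (b := √3)).exists_bound_of_continuousOn
    (continuous_synthCLM (n := n) (Φ := Φ) (N := N)).continuousOn
  refine ⟨|S| * |R| + 1, by positivity, fun c hc z hz => ?_⟩
  rw [← synthCLM_apply]
  have h1 := (synthCLM n Φ N z).le_opNorm c
  have h2 : ‖synthCLM n Φ N z‖ ≤ |S| := (hS z hz).trans (le_abs_self S)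
  have h3 : ‖c‖ ≤ |R| := hc.trans (le_abs_self R)
  have h4 := mul_le_mul h2 h3 (norm_nonneg c) (abs_nonneg S)
  linarith

lemma memLp_linearized (hab : a < b) (hf : ContinuousOn (Function.uncurry f) (univ ×ˢ Icc a b))
    (hlip : LocLipUnif f (Icc a b)) (c h : Coeff n N) : MemLp (linearized f a b Φ c h) 2 lebXi := by
  obtain ⟨M, hM, hc⟩ := exists_norm_synth_le (n := n) (Φ := Φ) (N := N) ‖c‖
  obtain ⟨M', hM', hh⟩ := exists_norm_synth_le (n := n) (Φ := Φ) (N := N) ‖h‖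
  obtain ⟨B, hB, hD⟩ := hlip.exists_norm_stateDeriv_le hM
  have hmeas := (isBoundedBilinearMap_apply (𝕜 := ℝ)).continuous.comp_aestronglyMeasurable
    ((aestronglyMeasurable_stateDeriv hab hf (continuous_synth (Φ := Φ) c)).prodMk
      (continuous_synth (Φ := Φ) h).aestronglyMeasurable)
  refine MemLp.of_bound hmeas (B * M') ?_
  filter_upwards [ae_mem_Ixi] with z hz
  exact ((stateDeriv f (synth Φ c z) (param a b z)).le_opNorm _).trans
    (mul_le_mul (hD _ (hc c le_rfl z hz) _ (param_mem hab hz)) (hh h le_rfl z hz)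
      (norm_nonneg _) hB)

/-- The Galerkin operator is differentiable, and its Jacobian is the projection of the
linearization. -/
lemma exists_hasFDerivAt_galerkin (hab : a < b)
    (hf : ContinuousOn (Function.uncurry f) (univ ×ˢ Icc a b)) (hlip : LocLipUnif f (Icc a b))
    (hdiff : ∀ m ∈ Icc a b, Differentiable ℝ (fun v => f v m)) (c : Coeff n N) :
    ∃ J : Coeff n N →L[ℝ] Coeff n N, HasFDerivAt (galerkin f a b Φ N) J c ∧
      ∀ h, J h = projCoeff Φ N (linearized f a b Φ c h) := by
  obtain ⟨M, hM, hc⟩ := exists_norm_synth_le (n := n) (Φ := Φ) (N := N) (‖c‖ + 1)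
  obtain ⟨B, hB, hD⟩ := hlip.exists_norm_stateDeriv_le hM
  obtain ⟨S, hS⟩ := (isCompact_Icc (a := -√3) (b := √3)).exists_bound_of_continuousOn
    (continuous_synthCLM (n := n) (Φ := Φ) (N := N)).continuousOn
  -- The candidate derivative of each integrand, by the chain rule. On the unit ball around `c` the
  -- synthesised curves stay in the ball of radius `M`, so `|Φ_i| B S` dominates it and
  -- differentiation under the integral is allowed.
  let F' : Fin (N + 1) → Coeff n N → ℝ → Coeff n N →L[ℝ] EuclideanSpace ℝ (Fin n) := fun i x z =>
    (Φ i).eval z • (stateDeriv f (synth Φ x z) (param a b z) ∘L synthCLM n Φ N z)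
  have hmeas : ∀ i x, AEStronglyMeasurable (F' i x) lebXi := by
    intro i x
    have h1 := (aestronglyMeasurable_stateDeriv hab hf (continuous_synth (Φ := Φ) x)).prodMk
      (continuous_synthCLM (n := n) (Φ := Φ) (N := N)).aestronglyMeasurable
    exact (Φ i).continuous.aestronglyMeasurable.smul
      ((continuous_fst.clm_comp continuous_snd).comp_aestronglyMeasurable h1)
  have hbound : ∀ i : Fin (N + 1), ∀ z ∈ Ixi, ∀ x ∈ Metric.ball c 1,
      ‖F' i x z‖ ≤ |(Φ i).eval z| * (B * S) := by
    intro i z hz x hx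
    have hx1 : ‖x‖ ≤ ‖c‖ + 1 := by
      have h1 : ‖x - c‖ < 1 := by rwa [← dist_eq_norm]
      have h2 := norm_add_le (x - c) c
      rw [sub_add_cancel] at h2
      linarith
    rw [norm_smul, Real.norm_eq_abs]
    refine mul_le_mul_of_nonneg_left ((ContinuousLinearMap.opNorm_comp_le _ _).trans ?_)
      (abs_nonneg _)
    exact mul_le_mul (hD _ (hc x hx1 z hz) _ (param_mem hab hz)) (hS z hz) (norm_nonneg _) hB
  have hbi : ∀ i : Fin (N + 1), Integrable (fun z => |(Φ i).eval z| * (B * S)) lebXi := fun i =>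
    (integrable_polynomial (Φ i)).abs.mul_const _
  have hder : ∀ i : Fin (N + 1), HasFDerivAt
      (fun x : Coeff n N => ∫ z, (Φ i).eval z • nemytskii f a b (synth Φ x) z ∂lebXi)
      (∫ z, F' i c z ∂lebXi) c := by
    intro i
    have hint : ∀ x : Coeff n N,
        Integrable (fun z => (Φ i).eval z • nemytskii f a b (synth Φ x) z) lebXi := fun x =>
      integrable_lebXi_of_continuousOn ((Φ i).continuous.continuousOn.smul
        (continuousOn_nemytskii hab hf (continuous_synth x)))
    refine hasFDerivAt_integral_of_dominated_of_fderiv_le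
      (F := fun (x : Coeff n N) z => (Φ i).eval z • nemytskii f a b (synth Φ x) z) (F' := F' i)
      (Metric.ball_mem_nhds c one_pos)
      (Eventually.of_forall fun x => (hint x).aestronglyMeasurable) (hint c) (hmeas i c)
      (ae_mem_Ixi.mono fun z hz => hbound i z hz) (hbi i) (ae_mem_Ixi.mono fun z hz x _ => ?_)
    have h1 : HasFDerivAt (fun v => f v (param a b z)) (stateDeriv f (synth Φ x z) (param a b z))
        (synthCLM n Φ N z x) := by
      rw [synthCLM_apply]
      exact (hdiff _ (param_mem hab hz) _).hasFDerivAt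
    have h2 := (h1.comp x (synthCLM n Φ N z).hasFDerivAt).const_smul ((Φ i).eval z)
    refine h2.congr_of_eventuallyEq (Eventually.of_forall fun y => ?_)
    simp only [nemytskii, Pi.smul_apply, Function.comp_apply, synthCLM_apply]
  refine ⟨ContinuousLinearMap.pi fun i => (sqNorm Φ i)⁻¹ • ∫ z, F' i c z ∂lebXi,
    hasFDerivAt_pi.2 fun i => ((hder i).const_smul (sqNorm Φ i)⁻¹ :), fun h => ?_⟩
  funext i
  have hi : Integrable (F' i c) lebXi := (hbi i).mono' (hmeas i c)
    (ae_mem_Ixi.mono fun z hz => hbound i z hz c (Metric.mem_ball_self one_pos))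
  simp only [ContinuousLinearMap.pi_apply, smul_apply, projCoeff]
  rw [ContinuousLinearMap.integral_apply hi]
  simp only [F', linearized, smul_apply, ContinuousLinearMap.comp_apply,
    synthCLM_apply]

/-! ### The induced operator norm -/

lemma starOpNorm_le {A : Coeff n N →L[ℝ] Coeff n N} {C : ℝ} (hC : 0 ≤ C)
    (h : ∀ c, starNorm Φ (A c) ≤ C * starNorm Φ c) : starOpNorm Φ A ≤ C :=
  csInf_le ⟨0, fun _ hx => hx.1⟩ ⟨hC, h⟩

/-- A lower bound gives injectivity, hence bijectivity in finite dimension; applied to `A.inverse c`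
it bounds the inverse. -/
lemma IsOrthogonalFamily.isInvertible_of_le (hΦ : IsOrthogonalFamily Φ)
    {A : Coeff n N →L[ℝ] Coeff n N} {m : ℝ} (hm : 0 < m)
    (h : ∀ c, m * starNorm Φ c ≤ starNorm Φ (A c)) :
    A.IsInvertible ∧ starOpNorm Φ A.inverse ≤ m⁻¹ := by
  have hinj : Function.Injective A := by
    refine (injective_iff_map_eq_zero A).2 fun c hc => hΦ.eq_zero_of_starNorm ?_
    have h1 := h c
    rw [hc, show starNorm Φ (0 : Coeff n N) = 0 by simp [starNorm]] at h1
    exact le_antisymm (by by_contra h2; nlinarith) (starNorm_nonneg c)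
  have hinv : A.IsInvertible :=
    ⟨(LinearEquiv.ofInjectiveEndo (A : Coeff n N →ₗ[ℝ] Coeff n N) hinj).toContinuousLinearEquiv,
      by ext1 c; rfl⟩
  refine ⟨hinv, starOpNorm_le (inv_nonneg.2 hm.le) fun c => ?_⟩
  have h1 := h (A.inverse c)
  rw [hinv.self_apply_inverse] at h1
  rwa [le_inv_mul_iff₀ hm]

/-! ### Coercivity and Lipschitz continuity of the Jacobian -/

/-- Test with `h`: the weighted inner product of the projected linearization with `h` is the
integral of the pointwise form, at least `m` times `starNorm Φ h ^ 2`. Cauchy–Schwarz then allows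
one factor to be cancelled. -/
lemma IsOrthogonalFamily.le_starNorm_projCoeff_linearized (hΦ : IsOrthogonalFamily Φ) (hab : a < b)
    (hf : ContinuousOn (Function.uncurry f) (univ ×ˢ Icc a b)) (hlip : LocLipUnif f (Icc a b))
    {c : Coeff n N} {m : ℝ}
    (hpos : ∀ z ∈ Ixi, ∀ w, m * ‖w‖ ^ 2 ≤
      inner ℝ (stateDeriv f (synth Φ c z) (param a b z) w) w) (h : Coeff n N) :
    m * starNorm Φ h ≤ starNorm Φ (projCoeff Φ N (linearized f a b Φ c h)) := by
  have hmem := memLp_linearized (Φ := Φ) hab hf hlip c h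
  have h1 : m * starNorm Φ h ^ 2 ≤
      starNorm Φ (projCoeff Φ N (linearized f a b Φ c h)) * starNorm Φ h := by
    refine le_trans ?_ (hΦ.sum_inner_le _ _)
    rw [hΦ.sum_inner_projCoeff hmem, hΦ.starNorm_sq_eq_integral, ← integral_const_mul]
    refine integral_mono_ae (((memLp_synth h).integrable_norm_pow (by norm_num)).const_mul m)
      (integrable_inner_of_memLp hmem (memLp_synth h)) ?_
    filter_upwards [ae_mem_Ixi] with z hz using hpos z hz _
  rcases (starNorm_nonneg (Φ := Φ) h).eq_or_lt with h0 | h0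
  · rw [← h0, mul_zero]; exact starNorm_nonneg _
  · exact le_of_mul_le_mul_right (by linarith) h0

/-- Bessel removes the projection. The difference of the two curves is kept in `L²`, where Parseval
applies, while the direction `d` is bounded in the maximum norm at the cost of `N + 1`. -/
lemma IsOrthogonalFamily.starNorm_projCoeff_linearized_sub_le (hΦ : IsOrthogonalFamily Φ)
    (hab : a < b) (hf : ContinuousOn (Function.uncurry f) (univ ×ˢ Icc a b))
    (hlip : LocLipUnif f (Icc a b)) {c₁ c₂ : Coeff n N} {L : ℝ} (hL : 0 ≤ L)
    (h : ∀ᵐ z ∂lebXi, ‖stateDeriv f (synth Φ c₁ z) (param a b z) -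
      stateDeriv f (synth Φ c₂ z) (param a b z)‖ ≤ L * ‖synth Φ c₁ z - synth Φ c₂ z‖)
    (d : Coeff n N) :
    starNorm Φ (projCoeff Φ N (linearized f a b Φ c₁ d) - projCoeff Φ N (linearized f a b Φ c₂ d)) ≤
      L * (N + 1) * starNorm Φ (c₁ - c₂) * starNorm Φ d := by
  have m1 := memLp_linearized (Φ := Φ) hab hf hlip c₁ d
  have m2 := memLp_linearized (Φ := Φ) hab hf hlip c₂ d
  have hsub : projCoeff Φ N (linearized f a b Φ c₁ d) - projCoeff Φ N (linearized f a b Φ c₂ d) =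
      projCoeff Φ N (linearized f a b Φ c₁ d - linearized f a b Φ c₂ d) := by
    funext i
    simp only [projCoeff, Pi.sub_apply, smul_sub]
    rw [integral_sub (integrable_eval_smul m1 (Φ i)) (integrable_eval_smul m2 (Φ i)), smul_sub]
  have hC : 0 ≤ L * (N + 1) * starNorm Φ d :=
    mul_nonneg (mul_nonneg hL (by positivity)) (starNorm_nonneg d)
  rw [hsub]
  refine abs_le_of_sq_le_sq' ?_ (mul_nonneg (mul_nonneg (mul_nonneg hL (by positivity))
    (starNorm_nonneg _)) (starNorm_nonneg _)) |>.2
  refine (hΦ.starNorm_projCoeff_sq_le (m1.sub m2)).trans ?_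
  rw [show (L * (N + 1) * starNorm Φ (c₁ - c₂) * starNorm Φ d) ^ 2 =
    (L * (N + 1) * starNorm Φ d) ^ 2 * starNorm Φ (c₁ - c₂) ^ 2 by ring,
    hΦ.starNorm_sq_eq_integral (c₁ - c₂), ← integral_const_mul]
  refine integral_mono_ae ((m1.sub m2).integrable_norm_pow (by norm_num))
    (((memLp_synth _).integrable_norm_pow (by norm_num)).const_mul _) ?_
  filter_upwards [ae_mem_Ixi, h] with z hz hzL
  rw [← mul_pow]
  refine pow_le_pow_left₀ (norm_nonneg _) ?_ 2
  rw [Pi.sub_apply, linearized, linearized, ← sub_apply, synth_sub]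
  refine (ContinuousLinearMap.le_opNorm _ _).trans ?_
  refine (mul_le_mul hzL (hΦ.norm_synth_le d hz) (norm_nonneg _) (by positivity)).trans
    (le_of_eq (by ring))

end Jacobian

end PCE
-- Main theorem: choice of constants and assembly.
theorem mainTheorem4 {n : ℕ} {a b : ℝ} (hab : a < b)
    (f : EuclideanSpace ℝ (Fin n) → ℝ → EuclideanSpace ℝ (Fin n))
    (hf_cont : ContinuousOn (Function.uncurry f) (univ ×ˢ Icc a b))
    (hf_lip : PCE.LocLipUnif f (Icc a b))
    (hf_diff : ∀ m ∈ Icc a b, Differentiable ℝ (fun v => f v m))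
    (hDf_lip : PCE.LocLipUnif (PCE.stateDeriv f) (Icc a b))
    (Φ : ℕ → Polynomial ℝ) (hΦ : PCE.IsOrthogonalFamily Φ)
    (u : ℝ → EuclideanSpace ℝ (Fin n)) (hu_cont : ContinuousOn u PCE.Ixi)
    (hu_branch : ∀ z ∈ PCE.Ixi, PCE.nemytskii f a b u z = 0)
    (s : ℝ) (hs : 1 ≤ s) (hu_sob : PCE.MemHs s u)
    (lam : ℝ) (hlam : 0 < lam)
    (hpos : ∀ z ∈ PCE.Ixi, ∀ w : EuclideanSpace ℝ (Fin n),
      lam * ‖w‖ ^ 2 ≤ inner ℝ (PCE.stateDeriv f (u z) (PCE.param a b z) w) w) :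
    ∃ N₀ : ℕ, 0 < N₀ ∧ ∃ U : Set (ℝ → EuclideanSpace ℝ (Fin n)), PCE.IsLinftyNhd U u ∧
      ∃ K : ℕ → ℝ, K =O[atTop] (fun N : ℕ => (N : ℝ)) ∧
        ∀ N : ℕ, N₀ ≤ N →
          Differentiable ℝ (PCE.galerkin f a b Φ N) ∧
          (PCE.galerkinJacobian f a b Φ N (PCE.projCoeff Φ N u)).IsInvertible ∧
          PCE.starOpNorm Φ
            (PCE.galerkinJacobian f a b Φ N (PCE.projCoeff Φ N u)).inverse ≤ 2 / lam ∧
          ∀ c₁ c₂ : PCE.Coeff n N, PCE.synth Φ c₁ ∈ U → PCE.synth Φ c₂ ∈ U →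
            PCE.starOpNorm Φ
              (PCE.galerkinJacobian f a b Φ N c₁ - PCE.galerkinJacobian f a b Φ N c₂) ≤
              K N * PCE.starNorm Φ (c₁ - c₂) := by

  obtain ⟨M₀, hM₀⟩ := isCompact_Icc.exists_bound_of_continuousOn hu_cont
  -- The extra `1` leaves room around the branch, so one Lipschitz constant serves its projections
  -- and all curves in `U`.
  set M : ℝ := |M₀| + 1 with hM
  have hMpos : 0 < M := by positivity
  have huM : ∀ z ∈ PCE.Ixi, ‖u z‖ + 1 ≤ M := fun z hz => by
    linarith [hM₀ z hz, le_abs_self M₀]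
  obtain ⟨L, hL, hLip⟩ := hDf_lip M hMpos
  -- The bound `1` keeps the projection in the ball of radius `M`; the other makes `D_u f` move by
  -- at most `L δ ≤ lam / 2`.
  set δ : ℝ := min 1 (lam / (2 * L)) with hδ
  have hδpos : 0 < δ := lt_min one_pos (by positivity)
  obtain ⟨N₁, hN₁⟩ := eventually_atTop.1
    (hΦ.eventually_norm_sub_synth_le hu_cont hs hu_sob hδpos)
  have hJ := fun (N : ℕ) (c : PCE.Coeff n N) =>
    PCE.exists_hasFDerivAt_galerkin (Φ := Φ) hab hf_cont hf_lip hf_diff c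
  have hJac : ∀ (N : ℕ) (c h : PCE.Coeff n N), PCE.galerkinJacobian f a b Φ N c h =
      PCE.projCoeff Φ N (PCE.linearized f a b Φ c h) := by
    intro N c h
    obtain ⟨J, hJ1, hJ2⟩ := hJ N c
    rw [PCE.galerkinJacobian, hJ1.fderiv, hJ2]
  refine ⟨N₁ + 1, Nat.succ_pos _, {v | AEStronglyMeasurable v PCE.lebXi ∧
    eLpNorm (v - u) ∞ PCE.lebXi < ENNReal.ofReal 1}, ⟨1, one_pos, fun v hv hvu => ⟨hv, hvu⟩⟩,
    fun N => L * (N + 1), ?_, fun N hN => ⟨?_, ?_⟩⟩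
  · refine IsBigO.of_bound (2 * L) ?_
    filter_upwards [eventually_ge_atTop 1] with N hN
    have h1 : (1 : ℝ) ≤ N := by exact_mod_cast hN
    rw [Real.norm_of_nonneg (by positivity), Real.norm_of_nonneg (by positivity)]
    nlinarith
  · intro c
    obtain ⟨J, hJ1, -⟩ := hJ N c
    exact hJ1.differentiableAt
  rw [← and_assoc]
  constructor
  · have hcoer : ∀ z ∈ PCE.Ixi, ∀ w, lam / 2 * ‖w‖ ^ 2 ≤ inner ℝ (PCE.stateDeriv f
        (PCE.synth Φ (PCE.projCoeff Φ N u) z) (PCE.param a b z) w) w := by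
      intro z hz w
      set p := PCE.synth Φ (PCE.projCoeff Φ N u) z with hp
      have hd : ‖u z - p‖ ≤ δ := hN₁ N (by omega) z hz
      have hpM : ‖p‖ ≤ M := by
        have h1 := norm_sub_le (u z) (u z - p)
        rw [sub_sub_cancel] at h1
        linarith [huM z hz, min_le_left 1 (lam / (2 * L))]
      have h1 := hLip (u z) p (by linarith [huM z hz]) hpM _ (PCE.param_mem hab hz)
      have h2 : ‖PCE.stateDeriv f (u z) (PCE.param a b z) -
          PCE.stateDeriv f p (PCE.param a b z)‖ ≤ lam / 2 := by
        refine h1.trans ((mul_le_mul_of_nonneg_left (hd.trans (min_le_right _ _)) hL.le).trans ?_)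
        apply le_of_eq
        field_simp
      have h3 : inner ℝ ((PCE.stateDeriv f (u z) (PCE.param a b z) -
          PCE.stateDeriv f p (PCE.param a b z)) w) w ≤ lam / 2 * ‖w‖ ^ 2 := by
        refine (real_inner_le_norm _ _).trans ?_
        have h4 := (PCE.stateDeriv f (u z) (PCE.param a b z) -
          PCE.stateDeriv f p (PCE.param a b z)).le_of_opNorm_le h2 w
        calc _ ≤ lam / 2 * ‖w‖ * ‖w‖ := mul_le_mul_of_nonneg_right h4 (norm_nonneg w)
          _ = _ := by ring
      rw [sub_apply, inner_sub_left] at h3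
      linarith [hpos z hz w]
    have h := hΦ.isInvertible_of_le (A := PCE.galerkinJacobian f a b Φ N (PCE.projCoeff Φ N u))
      (half_pos hlam) fun c => by
        rw [hJac]
        exact hΦ.le_starNorm_projCoeff_linearized hab hf_cont hf_lip hcoer c
    rwa [inv_div] at h
  · intro c₁ c₂ h₁ h₂
    -- Closeness in `L^∞` bounds the curve only almost everywhere, which suffices under the
    -- integral.
    have hbd : ∀ c : PCE.Coeff n N, eLpNorm (PCE.synth Φ c - u) ∞ PCE.lebXi < ENNReal.ofReal 1 →
        ∀ᵐ z ∂PCE.lebXi, ‖PCE.synth Φ c z‖ ≤ M := by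
      intro c hc
      rw [eLpNorm_exponent_top] at hc
      filter_upwards [ae_le_eLpNormEssSup (f := PCE.synth Φ c - u), PCE.ae_mem_Ixi] with z hz hzI
      have h1 := hz.trans_lt hc
      rw [Pi.sub_apply, ← ofReal_norm, ENNReal.ofReal_lt_ofReal_iff one_pos] at h1
      have h2 := norm_add_le (PCE.synth Φ c z - u z) (u z)
      rw [sub_add_cancel] at h2
      linarith [huM z hzI]
    refine PCE.starOpNorm_le (mul_nonneg (by positivity) (PCE.starNorm_nonneg _)) fun d => ?_
    rw [sub_apply, hJac, hJac]
    refine hΦ.starNorm_projCoeff_linearized_sub_le hab hf_cont hf_lip hL.le ?_ d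
    filter_upwards [hbd c₁ h₁.2, hbd c₂ h₂.2, PCE.ae_mem_Ixi] with z hz₁ hz₂ hz
    exact hLip _ _ hz₁ hz₂ _ (PCE.param_mem hab hz)
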